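/- For $c>0$ and $n\ge 1$ let $H_{n,n,n}$ be the multiple Hermite polynomial for the weights $w_1(x)=e^{-x^2-cx}$, $w_2(x)=e^{-x^2}$, $w_3(x)=e^{-x^2+cx}$ on $\mathbb R$, that is, the monic polynomial of degree $3n$ with $\int_{-\infty}^{\infty} x^k H_{n,n,n}(x)\,w_j(x)\,dx=0$ for $0\le k\le n-1$ and $j=1,2,3$. Theorem 3.2. The equation $t^6-\frac{27}{2}t^4-54t^2-54=0$ has exactly one positive root $c^*$, and $c^*\approx 4.10938818$ (rounded to eight decimals). Let $\hat c>0$ and, for each $n\ge 1$, take $c=\sqrt n\,\hat c$. Then $H_{n,n,n}$ exists and is unique, its $3n$ zeros $x_{1,3n}<\dots<x_{3n,3n}$ are real and simple, and there is a probability density $v$ on $\mathbb R$, depending only on $\hat c$, such that for every bounded continuous $f:\mathbb R\to\mathbb R$ \[ \lim_{n\to\infty}\frac1{3n}\sum_{j=1}^{3n} f\left(\frac{x_{j,3n}}{\sqrt n}\right)=\int_{-\infty}^{\infty} f(x)v(x)\,dx . \] If $\hat c>c^*$, then the support of the measure $v(x)\,dx$ is $[-b,-a]\cup[-d,d]\cup[a,b]$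 for some $0<d<a<b$; if $0<\hat c<c^*$, then it is $[-b,b]$ for some $b>0$. (The numbers $a,b,d$ depend on $\hat c$.) -/

import Mathlib

open Polynomial MeasureTheory Filter Topology
open scoped BoundedContinuousFunction

/-- `P` is a (type II) multiple orthogonal polynomial with multi-index `n` for the measures
`μ 0, …, μ (r-1)` on `ℝ`: it is monic of degree `∑ n_j`, and for every `j` it is orthogonal
to `1, x, …, x ^ (n_j - 1)` with respect to `μ j`. -/
def IsMultipleOrthogonal {r : ℕ} (μ : Fin r → Measure ℝ) (n : Fin r → ℕ) (P : ℝ[X]) : Prop :=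
  P.Monic ∧ P.natDegree = ∑ j, n j ∧
    ∀ j, ∀ k < n j,
      Integrable (fun x : ℝ => x ^ k * P.eval x) (μ j) ∧ ∫ x, x ^ k * P.eval x ∂(μ j) = 0

/-- The measure on `ℝ` with the Hermite-type weight function `exp (-x² + c x)`. -/
noncomputable def hermiteMeasure (c : ℝ) : Measure ℝ :=
  volume.withDensity fun x => ENNReal.ofReal (Real.exp (-x ^ 2 + c * x))

/-- `P` is the multiple Hermite polynomial `H_{n_1, …, n_r}` for the parameters
`c_1, …, c_r`. -/
def IsMultipleHermite {r : ℕ} (c : Fin r → ℝ) (n : Fin r → ℕ) (P : ℝ[X]) : Prop :=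
  IsMultipleOrthogonal (fun j => hermiteMeasure (c j)) n P

/-- `P` is `H_{n,n,n}` for the three weights `exp (-x² - c x)`, `exp (-x²)`,
`exp (-x² + c x)`. -/
def IsHnnn (c : ℝ) (n : ℕ) (P : ℝ[X]) : Prop :=
  IsMultipleHermite ![-c, 0, c] ![n, n, n] P

/-- `v` is a probability density on `ℝ` with respect to Lebesgue measure. -/
def IsProbabilityDensity (v : ℝ → ℝ) : Prop :=
  Measurable v ∧ (∀ x, 0 ≤ v x) ∧ Integrable v ∧ ∫ x, v x = 1

/-- The support of the density `v`: the closed support of the measure `v(x) dx`. -/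
noncomputable def densitySupport (v : ℝ → ℝ) : Set ℝ :=
  (volume.withDensity fun x => ENNReal.ofReal (v x)).support

/-!
The polynomial `H_{n,n,n}` is the image of `R = ((X + c/2) X (X - c/2)) ^ n` under the backward heat
flow `T = exp (-D² / 4)`, which satisfies `T ((X - a) R) = (X - a) T R - (T R)' / 2`
(`heat_X_sub_C_mul`). Integration by parts makes `P ↦ (X - a) P - P' / 2` the adjoint of `q ↦ q' / 2`
for the weight `exp (-x² + 2 a x)`, so orthogonality of `T R` to polynomials of degree less than `n`
means that `R` vanishes to order `n` at `a` (`orthogonal_heat_iff`). As `T` is invertible and keeps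
monic polynomials monic of the same degree, existence and uniqueness follow (`isHnnn_iff`). The same
operator preserves the property of having only real simple zeros (`HasSimpleRealRoots.raising`).

Applying `T` to `q R' = n q' R`, with `q = X³ - (c/2)² X`, gives a fourth-order differential equation
for `H_{n,n,n}`. After rescaling by `√n`, and with `h = ĉ / 2`, it becomes in the limit an algebraic
equation for the Cauchy transform `G` of the zero distribution: `w = z - (3/2) G(z)` satisfies
`ψ(w) = z`, where `ψ(w) = w + (1/2) ∑ 1 / (w - a)`, the sum being over `a = -h, 0, h`
(`algebraic_equation_of_tendsto`). In other words, the limit is the free convolution of the uniform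
distribution on these three points with a semicircle law. Since `Im ψ(w) = Im w (1 - S(w))` with
`S(w) = (1/2) ∑ 1 / |w - a|²`, solutions in the upper half-plane satisfy `S(w) < 1`, and a
divided-difference estimate shows that there is at most one (`sourceMap_injective`). Compactness
(Prokhorov's theorem) together with the fact that the Cauchy transform determines the measure
(`eq_of_cauchyTransform_eq`) then yields weak convergence (`exists_limit_measure`).

The bound `S(w) < 1` keeps `Im G` bounded, so the limit has a bounded density. Its support is the
complement of `ψ(V)`, where `V` is the set of real `u`, not a pole, with `ψ'(u) > 0`
(`SolvesSourceEquation.support_eq`): at points of `V` the same estimate shows that `w` has real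
boundary values, and conversely at a point outside the support the boundary value of `w` lies in `V`.
The sign of `ψ'(u)` is that of a cubic in `u²`. The cubic always has one root beyond `h²`; it is
positive somewhere on `(0, h²)`, which opens two further gaps, exactly when `ĉ` exceeds the value `c*`
at which it has a double root there.
-/

/-! ### The backward heat operator on polynomials -/

/-- The operator `P ↦ X P + s P'` on real polynomials. -/
noncomputable def raising (s : ℝ) : Module.End ℝ ℝ[X] :=
  LinearMap.mulLeft ℝ X + s • derivative

/-- The heat flow `exp (s D² / 2)` on real polynomials. Since `exp (s D² / 2)` intertwines
multiplication by `X` with `raising s` and fixes `1`, it is encoded as the polynomial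
in the operator `raising s`, applied to `1`. -/
noncomputable def heat (s : ℝ) (R : ℝ[X]) : ℝ[X] := aeval (raising s) R 1

lemma raising_apply (s : ℝ) (P : ℝ[X]) : raising s P = X * P + s • derivative P := by
  simp [raising]

lemma heat_mul (s : ℝ) (R Q : ℝ[X]) : heat s (R * Q) = aeval (raising s) R (heat s Q) := by
  simp [heat]

lemma heat_one (s : ℝ) : heat s 1 = 1 := by simp [heat]

lemma heat_X_mul (s : ℝ) (R : ℝ[X]) : heat s (X * R) = raising s (heat s R) := by
  simp [heat_mul]

lemma heat_add (s : ℝ) (R Q : ℝ[X]) : heat s (R + Q) = heat s R + heat s Q := by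
  simp [heat]

lemma heat_C_mul (s r : ℝ) (R : ℝ[X]) : heat s (C r * R) = C r * heat s R := by
  rw [heat_mul]; simp [Module.algebraMap_end_apply, smul_eq_C_mul]

lemma heat_X_sub_C_mul (s a : ℝ) (R : ℝ[X]) :
    heat s ((X - C a) * R) = (X - C a) * heat s R + s • derivative (heat s R) := by
  rw [heat_mul]; simp [Module.algebraMap_end_apply, smul_eq_C_mul, raising_apply]; ring

lemma heat_natCast_mul (s : ℝ) (n : ℕ) (R : ℝ[X]) : heat s (n * R) = n * heat s R := by
  simpa using heat_C_mul s n R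

/-- The heat flow commutes with differentiation. -/
lemma derivative_heat (s : ℝ) (R : ℝ[X]) : derivative (heat s R) = heat s (derivative R) := by
  induction R using Polynomial.induction_on' with
  | add p q hp hq => rw [heat_add, derivative_add, hp, hq, derivative_add, heat_add]
  | monomial n r =>
    rw [← C_mul_X_pow_eq_monomial, heat_C_mul, derivative_C_mul, derivative_C_mul, heat_C_mul]
    congr 1
    induction n with
    | zero => simp [heat]
    | succ n ih =>
      have h1 : heat s (derivative (X ^ n)) = n * heat s (X ^ (n - 1)) := by
        rw [derivative_X_pow, C_eq_natCast, heat_natCast_mul]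
      have h2 : derivative (derivative (heat s (X ^ n)))
          = n * derivative (heat s (X ^ (n - 1))) := by
        rw [ih, h1, derivative_mul]; simp
      rw [derivative_X_pow, C_eq_natCast, heat_natCast_mul, Nat.add_sub_cancel, pow_succ',
        heat_X_mul, raising_apply, derivative_add, derivative_mul, derivative_X, derivative_smul,
        h2, ih, h1]
      rcases n with _ | n
      · simp
      · have h3 : heat s (X ^ (n + 1)) = X * heat s (X ^ n) + s • derivative (heat s (X ^ n)) := by
          rw [pow_succ', heat_X_mul, raising_apply]
        rw [Nat.add_sub_cancel, h3]
        simp only [smul_eq_C_mul]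
        push_cast
        ring

/-- The flows with opposite times are inverse to each other. -/
lemma heat_neg_heat (s : ℝ) (R : ℝ[X]) : heat (-s) (heat s R) = R := by
  induction R using Polynomial.induction_on' with
  | add p q hp hq => rw [heat_add, heat_add, hp, hq]
  | monomial n r =>
    rw [← C_mul_X_pow_eq_monomial, heat_C_mul, heat_C_mul]
    congr 1
    induction n with
    | zero => simp [heat_one]
    | succ n ih =>
      rw [pow_succ', heat_X_mul, raising_apply, heat_add, heat_X_mul, raising_apply, smul_eq_C_mul,
        smul_eq_C_mul, heat_C_mul, ← derivative_heat, ih, C_neg]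
      ring

lemma degree_smul_derivative_lt (s : ℝ) {P : ℝ[X]} {Q : ℝ[X]} (hQ : Q.Monic)
    (hP : P.Monic) : (s • derivative P).degree < (Q * P).degree := by
  rw [degree_mul, degree_eq_natDegree hP.ne_zero, degree_eq_natDegree hQ.ne_zero]
  calc (s • derivative P).degree ≤ (derivative P).degree := degree_smul_le _ _
    _ < P.degree := degree_derivative_lt hP.ne_zero
    _ = (P.natDegree : WithBot ℕ) := degree_eq_natDegree hP.ne_zero
    _ ≤ _ := by exact_mod_cast Nat.le_add_left _ _

lemma monic_X_sub_C_mul_add {P : ℝ[X]} (hP : P.Monic) (a s : ℝ) :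
    ((X - C a) * P + s • derivative P).Monic ∧
      ((X - C a) * P + s • derivative P).natDegree = P.natDegree + 1 := by
  have h := degree_smul_derivative_lt s (monic_X_sub_C a) hP
  refine ⟨((monic_X_sub_C a).mul hP).add_of_left h, ?_⟩
  rw [natDegree_eq_of_degree_eq (degree_add_eq_left_of_degree_lt h),
    (monic_X_sub_C a).natDegree_mul hP, natDegree_X_sub_C, add_comm]

lemma monic_heat_X_pow (s : ℝ) (n : ℕ) :
    (heat s (X ^ n)).Monic ∧ (heat s (X ^ n)).natDegree = n := by
  induction n with
  | zero => simp [heat_one]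
  | succ n ih =>
    have := monic_X_sub_C_mul_add ih.1 0 s
    rw [← heat_X_sub_C_mul, C_0, sub_zero, ← pow_succ', ih.2] at this
    exact this

/-- The heat flow preserves the degree and the leading coefficient. -/
lemma heat_natDegree_le_and_coeff (s : ℝ) {R : ℝ[X]} {m : ℕ} (h : R.natDegree ≤ m) :
    (heat s R).natDegree ≤ m ∧ (heat s R).coeff m = R.coeff m := by
  have key : heat s R = ∑ i ∈ Finset.range (m + 1), C (R.coeff i) * heat s (X ^ i) := by
    conv_lhs => rw [R.as_sum_range_C_mul_X_pow' (n := m + 1) (by omega)]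
    simp only [heat, map_sum, LinearMap.sum_apply]
    exact Finset.sum_congr rfl fun i _ => heat_C_mul s _ _
  constructor
  · rw [key]
    refine natDegree_sum_le_of_forall_le _ _ fun i hi => ?_
    refine (natDegree_C_mul_le _ _).trans ?_
    rw [(monic_heat_X_pow s i).2]
    have := Finset.mem_range.1 hi; omega
  · rw [key, finsetSum_coeff, Finset.sum_range_succ, Finset.sum_eq_zero, zero_add, coeff_C_mul]
    · have := (monic_heat_X_pow s m).1.coeff_natDegree
      rw [(monic_heat_X_pow s m).2] at this
      rw [this, mul_one]
    · intro i hi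
      rw [coeff_C_mul, coeff_eq_zero_of_natDegree_lt (p := heat s (X ^ i)), mul_zero]
      rw [(monic_heat_X_pow s i).2]
      exact Finset.mem_range.1 hi

lemma monic_heat {s : ℝ} {R : ℝ[X]} (hR : R.Monic) :
    (heat s R).Monic ∧ (heat s R).natDegree = R.natDegree := by
  obtain ⟨h1, h2⟩ := heat_natDegree_le_and_coeff s (R := R) le_rfl
  have h3 : (heat s R).coeff R.natDegree = 1 := by rw [h2, hR.coeff_natDegree]
  have h4 : (heat s R).natDegree = R.natDegree :=
    le_antisymm h1 (le_natDegree_of_ne_zero (by rw [h3]; exact one_ne_zero))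
  refine ⟨?_, h4⟩
  rw [Monic, leadingCoeff, h4, h3]

/-- The differential equation satisfied by the image of `q ^ n` under the heat flow. -/
lemma heat_pow_ode (s : ℝ) (q : ℝ[X]) (n : ℕ) :
    aeval (raising s) q (derivative (heat s (q ^ n))) =
      (n : ℝ[X]) * aeval (raising s) (derivative q) (heat s (q ^ n)) := by
  rw [derivative_heat, ← heat_mul, ← heat_mul, ← heat_natCast_mul]
  congr 1
  rcases n with _ | n
  · simp
  · rw [derivative_pow_succ]
    push_cast
    simp only [map_add, map_natCast, map_one]
    ring

/-! ### Orthogonality and the heat operator -/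

lemma integrable_eval_mul_gaussian (P : ℝ[X]) (a : ℝ) :
    Integrable fun x : ℝ => P.eval x * Real.exp (-x ^ 2 + 2 * a * x) := by
  have h0 : ∀ Q : ℝ[X], Integrable fun x : ℝ => Q.eval x * Real.exp (-x ^ 2) := by
    intro Q
    induction Q using Polynomial.induction_on' with
    | add p q hp hq =>
      refine (hp.add hq).congr (ae_of_all _ fun x => ?_)
      simp [add_mul]
    | monomial n r =>
      have := (integrable_rpow_mul_exp_neg_mul_sq (b := 1) one_pos (s := n)
        (by linarith [(Nat.cast_nonneg n : (0 : ℝ) ≤ n)])).const_mul r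
      simpa [mul_assoc] using this
  have h1 := ((h0 (P.comp (X + C a))).comp_sub_right a).const_mul (Real.exp (a ^ 2))
  refine h1.congr (ae_of_all _ fun x => ?_)
  have h2 : -x ^ 2 + 2 * a * x = a ^ 2 + -(x - a) ^ 2 := by ring
  simp only [eval_comp, eval_add, eval_X, eval_C, sub_add_cancel, h2, Real.exp_add]
  ring

/-- The integral of a polynomial against the Gaussian weight `exp (-x² + 2 a x)`. -/
noncomputable def gaussianIntegral (a : ℝ) (P : ℝ[X]) : ℝ :=
  ∫ x : ℝ, P.eval x * Real.exp (-x ^ 2 + 2 * a * x)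

lemma gaussianIntegral_add (a : ℝ) (P Q : ℝ[X]) :
    gaussianIntegral a (P + Q) = gaussianIntegral a P + gaussianIntegral a Q := by
  rw [gaussianIntegral, gaussianIntegral, gaussianIntegral,
    ← integral_add (integrable_eval_mul_gaussian P a) (integrable_eval_mul_gaussian Q a)]
  simp [add_mul]

lemma gaussianIntegral_C_mul (a r : ℝ) (P : ℝ[X]) :
    gaussianIntegral a (C r * P) = r * gaussianIntegral a P := by
  rw [gaussianIntegral, gaussianIntegral, ← integral_const_mul]
  simp [mul_assoc]

lemma gaussianIntegral_one_pos (a : ℝ) : 0 < gaussianIntegral a 1 := by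
  rw [gaussianIntegral]
  have h := integrable_eval_mul_gaussian 1 a
  refine (integral_pos_iff_support_of_nonneg (fun x => ?_) h).2 ?_
  · simp [Real.exp_nonneg]
  · have : Function.support (fun x : ℝ => (1 : ℝ[X]).eval x * Real.exp (-x ^ 2 + 2 * a * x))
        = Set.univ := by
      ext x; simp [Real.exp_ne_zero]
    rw [this]; simp

/-- Integration by parts against the weight `exp (-x² + 2 a x)`: the operator
`P ↦ (X - a) P - P' / 2` is the adjoint of `q ↦ q' / 2`. -/
lemma gaussianIntegral_by_parts (a : ℝ) (q P : ℝ[X]) :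
    gaussianIntegral a (q * ((X - C a) * P + (-1 / 2 : ℝ) • derivative P)) =
      1 / 2 * gaussianIntegral a (derivative q * P) := by
  have h : gaussianIntegral a (derivative (q * P) + q * P * (C (2 * a) - C 2 * X)) = 0 := by
    rw [gaussianIntegral]
    refine integral_eq_zero_of_hasDerivAt_of_integrable
      (f := fun x => (q * P).eval x * Real.exp (-x ^ 2 + 2 * a * x)) (fun x => ?_)
      (integrable_eval_mul_gaussian _ a) (integrable_eval_mul_gaussian _ a)
    have h1 : HasDerivAt (fun x : ℝ => -x ^ 2 + 2 * a * x) (-(2 * x) + 2 * a) x := by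
      have h2 := (((hasDerivAt_id x).pow 2).neg).add ((hasDerivAt_id x).const_mul (2 * a))
      exact h2.congr_deriv (by simp)
    refine (((q * P).hasDerivAt x).mul h1.exp).congr_deriv ?_
    simp only [eval_add, eval_mul, eval_sub, eval_C, eval_X]
    ring
  have h3 : q * ((X - C a) * P + (-1 / 2 : ℝ) • derivative P) =
      C (1 / 2) * (derivative q * P) +
        C (-1 / 2) * (derivative (q * P) + q * P * (C (2 * a) - C 2 * X)) := by
    have h4 : (C (-1 / 2) : ℝ[X]) * C (2 * a) = - C a := by rw [← C_mul, ← C_neg]; congr 1; ring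
    have h5 : (C (-1 / 2) : ℝ[X]) * C 2 = - 1 := by rw [← C_mul, ← C_1, ← C_neg]; congr 1; ring
    have h6 : (C (1 / 2) : ℝ[X]) = - C (-1 / 2) := by rw [← C_neg]; congr 1; ring
    rw [derivative_mul, smul_eq_C_mul, h6]
    linear_combination (-q * P) * h4 + q * P * X * h5
  rw [h3, gaussianIntegral_add, gaussianIntegral_C_mul, gaussianIntegral_C_mul, h, mul_zero,
    add_zero]

/-- Factors `X - a` turn, under the heat flow, into derivatives of the test polynomial. -/
lemma gaussianIntegral_mul_heat (a : ℝ) (m : ℕ) (q R : ℝ[X]) :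
    gaussianIntegral a (q * heat (-1 / 2) ((X - C a) ^ m * R)) =
      (1 / 2) ^ m * gaussianIntegral a (derivative^[m] q * heat (-1 / 2) R) := by
  induction m generalizing q with
  | zero => simp
  | succ m ih =>
    rw [pow_succ' (X - C a), mul_assoc, heat_X_sub_C_mul, gaussianIntegral_by_parts, ih,
      Function.iterate_succ_apply]
    ring

lemma gaussianIntegral_heat (a : ℝ) (R : ℝ[X]) :
    gaussianIntegral a (heat (-1 / 2) R) = R.eval a * gaussianIntegral a 1 := by
  obtain ⟨Q, hQ⟩ : X - C a ∣ R - C (R.eval a) := by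
    rw [dvd_iff_isRoot]; simp
  have h1 : R = (X - C a) ^ 1 * Q + C (R.eval a) * 1 := by rw [pow_one, ← hQ]; ring
  have h2 := gaussianIntegral_mul_heat a 1 1 Q
  conv_lhs => rw [h1]
  rw [heat_add, gaussianIntegral_add, heat_C_mul, gaussianIntegral_C_mul, heat_one]
  rw [one_mul] at h2
  rw [h2]
  simp [gaussianIntegral]

/-- A polynomial in the image of the heat flow is orthogonal to `1, x, …, x ^ (n - 1)` for the
weight `exp (-x² + 2 a x)` exactly when its preimage vanishes to order `n` at `a`. -/
lemma orthogonal_heat_iff (a : ℝ) (n : ℕ) (R : ℝ[X]) :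
    (∀ k < n, gaussianIntegral a (X ^ k * heat (-1 / 2) R) = 0) ↔ (X - C a) ^ n ∣ R := by
  constructor
  · intro h
    by_cases hR : R = 0
    · simp [hR]
    by_contra hn
    obtain ⟨Q, hQ, hQ'⟩ := exists_eq_pow_rootMultiplicity_mul_and_not_dvd R hR a
    have hlt : rootMultiplicity a R < n := by
      by_contra hle
      exact hn ((pow_dvd_pow _ (not_lt.1 hle)).trans (pow_rootMultiplicity_dvd R a))
    have h1 := h _ hlt
    set m := rootMultiplicity a R with hm
    have h2 := gaussianIntegral_mul_heat a m (X ^ m) Q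
    rw [← hQ, h1, iterate_derivative_X_pow_eq_C_mul, Nat.sub_self, pow_zero, mul_one,
      gaussianIntegral_C_mul, gaussianIntegral_heat, Nat.descFactorial_self] at h2
    have h3 : Q.eval a ≠ 0 := fun h0 => hQ' (dvd_iff_isRoot.2 h0)
    have h4 := (gaussianIntegral_one_pos a).ne'
    have h5 : (m.factorial : ℝ) ≠ 0 := by exact_mod_cast m.factorial_ne_zero
    exact (mul_ne_zero (pow_ne_zero m (by norm_num : (1 / 2 : ℝ) ≠ 0))
      (mul_ne_zero h5 (mul_ne_zero h3 h4))) h2.symm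
  · rintro ⟨Q, rfl⟩ k hk
    rw [gaussianIntegral_mul_heat, iterate_derivative_eq_zero (by simpa using hk)]
    simp [gaussianIntegral]

lemma isOrthogonal_hermiteMeasure_iff (c : ℝ) (k : ℕ) (P : ℝ[X]) :
    (Integrable (fun x : ℝ => x ^ k * P.eval x) (hermiteMeasure c) ∧
      ∫ x, x ^ k * P.eval x ∂(hermiteMeasure c) = 0) ↔
    gaussianIntegral (c / 2) (X ^ k * P) = 0 := by
  have hm : Measurable fun x : ℝ => Real.exp (-x ^ 2 + c * x) := by fun_prop
  have h1 : Integrable (fun x : ℝ => x ^ k * P.eval x) (hermiteMeasure c) := by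
    rw [hermiteMeasure, integrable_withDensity_iff hm.ennreal_ofReal (by simp)]
    have := integrable_eval_mul_gaussian (X ^ k * P) (c / 2)
    refine this.congr (ae_of_all _ fun x => ?_)
    simp only [eval_mul, eval_pow, eval_X, ENNReal.toReal_ofReal (Real.exp_nonneg _)]
    congr 3; ring
  have h2 : ∫ x, x ^ k * P.eval x ∂(hermiteMeasure c) = gaussianIntegral (c / 2) (X ^ k * P) := by
    rw [hermiteMeasure, integral_withDensity_eq_integral_toReal_smul hm.ennreal_ofReal (by simp),
      gaussianIntegral]
    refine integral_congr_ae (ae_of_all _ fun x => ?_)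
    simp only [eval_mul, eval_pow, eval_X, ENNReal.toReal_ofReal (Real.exp_nonneg _), smul_eq_mul]
    rw [mul_comm]
    congr 3; ring
  rw [h2]
  exact and_iff_right h1

/-- The polynomial `((X + a) X (X - a)) ^ n` whose image under the heat flow is `H_{n,n,n}`. -/
noncomputable def sourcePoly (a : ℝ) (n : ℕ) : ℝ[X] := (X ^ 3 - C (a ^ 2) * X) ^ n

lemma sourcePoly_eq (a : ℝ) (n : ℕ) :
    sourcePoly a n = (X - C (-a)) ^ n * ((X - C 0) ^ n * (X - C a) ^ n) := by
  rw [sourcePoly, ← mul_pow, ← mul_pow]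
  congr 1
  simp only [C_neg, C_0, C_pow]; ring

lemma monic_sourcePoly (a : ℝ) (n : ℕ) :
    (sourcePoly a n).Monic ∧ (sourcePoly a n).natDegree = 3 * n := by
  rw [sourcePoly_eq]
  have h := fun b : ℝ => (monic_X_sub_C b).pow n
  have h' : ∀ b : ℝ, ((X - C b) ^ n).natDegree = n := fun b => by simp
  refine ⟨(h _).mul ((h _).mul (h _)), ?_⟩
  rw [(h _).natDegree_mul ((h _).mul (h _)), (h _).natDegree_mul (h _), h', h', h']
  ring

/-- The multiple Hermite polynomial is the image of `((X + c/2) X (X - c/2)) ^ n` under the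
backward heat flow. -/
lemma isHnnn_iff {c : ℝ} (hc : 0 < c) (n : ℕ) (P : ℝ[X]) :
    IsHnnn c n P ↔ P = heat (-1 / 2) (sourcePoly (c / 2) n) := by
  have horth : IsHnnn c n P ↔ P.Monic ∧ P.natDegree = 3 * n ∧
      (∀ k < n, gaussianIntegral (-(c / 2)) (X ^ k * P) = 0) ∧
      (∀ k < n, gaussianIntegral 0 (X ^ k * P) = 0) ∧
      ∀ k < n, gaussianIntegral (c / 2) (X ^ k * P) = 0 := by
    rw [IsHnnn, IsMultipleHermite, IsMultipleOrthogonal]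
    simp only [isOrthogonal_hermiteMeasure_iff, Fin.forall_fin_succ, Fin.sum_univ_three]
    simp [neg_div, show 3 * n = n + n + n by ring]
  set R := heat (1 / 2) P with hR
  have hPR : P = heat (-1 / 2) R := by
    have := heat_neg_heat (1 / 2) P
    rw [hR, show (-1 / 2 : ℝ) = -(1 / 2) by ring, this]
  rw [horth]
  constructor
  · rintro ⟨hm, hd, h1, h2, h3⟩
    rw [hPR, orthogonal_heat_iff] at h1 h2 h3
    obtain ⟨hRm, hRd⟩ := monic_heat (s := 1 / 2) hm
    have hco : ∀ {x y : ℝ}, x ≠ y → IsCoprime ((X - C x) ^ n) ((X - C y) ^ n) := fun hxy =>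
      (isCoprime_X_sub_C_of_isUnit_sub (sub_ne_zero.2 hxy).isUnit).pow
    have hdvd : sourcePoly (c / 2) n ∣ R := by
      rw [sourcePoly_eq]
      refine IsCoprime.mul_dvd ?_ h1 (IsCoprime.mul_dvd (hco (by linarith)) h2 h3)
      exact IsCoprime.mul_right (hco (by linarith)) (hco (by linarith))
    rw [hPR]
    congr 1
    refine eq_of_monic_of_dvd_of_natDegree_le (monic_sourcePoly _ _).1 hRm hdvd ?_
    rw [hRd, hd, (monic_sourcePoly _ _).2]
  · intro h
    obtain ⟨hm, hd⟩ := monic_heat (s := -1 / 2) (monic_sourcePoly (c / 2) n).1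
    have hdvd := sourcePoly_eq (c / 2) n
    rw [h]
    refine ⟨hm, by rw [hd, (monic_sourcePoly _ _).2], ?_, ?_, ?_⟩ <;> rw [orthogonal_heat_iff, hdvd]
    · exact dvd_mul_right _ _
    · exact dvd_mul_of_dvd_right (dvd_mul_right _ _) _
    · exact dvd_mul_of_dvd_right (dvd_mul_left _ _) _

/-! ### Logarithmic derivatives and real zeros -/

/-- The sum `∑ 1 / (z - x) ^ j` over a multiset of real points `x`. -/
noncomputable def powerSumInv (m : Multiset ℝ) (j : ℕ) (z : ℂ) : ℂ :=
  (m.map fun x : ℝ => 1 / (z - x) ^ j).sum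

/-- The derivatives of order at most four of a polynomial with roots `m`, expressed by the
sums `∑ 1 / (z - x) ^ j`. -/
lemma aeval_derivatives_prod (m : Multiset ℝ) {z : ℂ} (hz : ∀ x ∈ m, z ≠ (x : ℝ)) :
    let P := (m.map fun x => X - C x).prod
    let s := fun j => powerSumInv m j z
    aeval z P ≠ 0 ∧ aeval z (derivative P) = aeval z P * s 1 ∧
      aeval z (derivative (derivative P)) = aeval z P * (s 1 ^ 2 - s 2) ∧
      aeval z (derivative (derivative (derivative P))) =
        aeval z P * (s 1 ^ 3 - 3 * s 1 * s 2 + 2 * s 3) ∧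
      aeval z (derivative (derivative (derivative (derivative P)))) =
        aeval z P * (s 1 ^ 4 - 6 * s 1 ^ 2 * s 2 + 8 * s 1 * s 3 + 3 * s 2 ^ 2 - 6 * s 4) := by
  induction m using Multiset.induction with
  | empty => simp [powerSumInv]
  | cons c m ih =>
    obtain ⟨h0, h1, h2, h3, h4⟩ := ih fun x hx => hz x (Multiset.mem_cons_of_mem hx)
    have hc : z - (c : ℂ) ≠ 0 := sub_ne_zero.2 (hz c (Multiset.mem_cons_self c m))
    have hs : ∀ j, powerSumInv (c ::ₘ m) j z = 1 / (z - c) ^ j + powerSumInv m j z := by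
      intro j; simp [powerSumInv]
    simp only [hs]
    simp only [Multiset.map_cons, Multiset.prod_cons, derivative_mul, derivative_X,
      derivative_C, sub_zero, one_mul, map_add, map_mul, map_sub, aeval_X, aeval_C,
      Complex.coe_algebraMap, h1, h2, h3, h4]
    refine ⟨mul_ne_zero hc h0, ?_, ?_, ?_, ?_⟩ <;> field_simp <;> ring

lemma im_powerSumInv_one (m : Multiset ℝ) (z : ℂ) :
    (powerSumInv m 1 z).im = -z.im * (m.map fun x : ℝ => 1 / Complex.normSq (z - x)).sum := by
  induction m using Multiset.induction with
  | empty => simp [powerSumInv]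
  | cons c m ih =>
    simp only [powerSumInv, Multiset.map_cons, Multiset.sum_cons, Complex.add_im, mul_add] at ih ⊢
    rw [ih]
    congr 1
    simp [Complex.inv_im, div_eq_mul_inv]

/-- Laguerre's inequality `P P'' ≤ P'²` for polynomials with only real zeros. -/
lemma laguerre_inequality (m : Multiset ℝ) (x : ℝ) :
    let P := (m.map fun x => X - C x).prod
    P.eval x * (derivative (derivative P)).eval x ≤ (derivative P).eval x ^ 2 := by
  induction m using Multiset.induction with
  | empty => simp
  | cons c m ih =>
    simp only [Multiset.map_cons, Multiset.prod_cons, derivative_mul, derivative_sub, derivative_X,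
      derivative_C, sub_zero, one_mul, derivative_add, eval_add, eval_mul, eval_sub, eval_X,
      eval_C] at ih ⊢
    nlinarith [mul_nonneg (sq_nonneg (x - c)) (sub_nonneg.2 ih),
      sq_nonneg (eval x (m.map fun x => X - C x).prod)]

/-- A monic real polynomial all of whose zeros are real and simple. -/
structure HasSimpleRealRoots (P : ℝ[X]) : Prop where
  monic : P.Monic
  card : Multiset.card P.roots = P.natDegree
  nodup : P.roots.Nodup

lemma HasSimpleRealRoots.prod_eq {P : ℝ[X]} (hP : HasSimpleRealRoots P) :
    (P.roots.map fun x => X - C x).prod = P :=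
  prod_multiset_X_sub_C_of_monic_of_roots_card_eq hP.monic hP.card

/-- The operator `P ↦ (X - a) P - P' / 2` preserves real-rootedness, because
`(z - a) - (1/2) ∑ 1 / (z - x)` has positive imaginary part in the upper half-plane, and it keeps
the zeros simple by Laguerre's inequality. -/
lemma HasSimpleRealRoots.raising {P : ℝ[X]} (hP : HasSimpleRealRoots P) (a : ℝ) :
    HasSimpleRealRoots ((X - C a) * P + (-1 / 2 : ℝ) • derivative P) := by
  set Q := (X - C a) * P + (-1 / 2 : ℝ) • derivative P with hQ
  have hmon : Q.Monic := (monic_X_sub_C_mul_add hP.monic a _).1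
  have hreal : ∀ z : ℂ, aeval z Q = 0 → z.im = 0 := by
    intro z hz
    by_contra hne
    have hzx : ∀ x ∈ P.roots, z ≠ (x : ℝ) := by
      rintro x - rfl; simp at hne
    obtain ⟨h0, h1, -⟩ := aeval_derivatives_prod P.roots hzx
    rw [hP.prod_eq] at h0 h1
    rw [hQ] at hz
    simp only [map_add, map_mul, map_sub, aeval_X, aeval_C, map_smul, h1, Complex.coe_algebraMap,
      Complex.real_smul] at hz
    have h2 : aeval z P * ((z - a) - 1 / 2 * powerSumInv P.roots 1 z) = 0 := by
      rw [← hz]; push_cast; ring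
    have h3 := (mul_eq_zero.1 h2).resolve_left h0
    have h4 := congrArg Complex.im h3
    have h5 : ((1 / 2 : ℂ) * powerSumInv P.roots 1 z).im = 1 / 2 * (powerSumInv P.roots 1 z).im := by
      have : (1 / 2 : ℂ) = ((1 / 2 : ℝ) : ℂ) := by push_cast; ring
      rw [this, Complex.im_ofReal_mul]
    rw [Complex.sub_im, Complex.sub_im, h5, im_powerSumInv_one] at h4
    simp only [Complex.ofReal_im, sub_zero, Complex.zero_im] at h4
    have h6 : 0 ≤ (P.roots.map fun x : ℝ => 1 / Complex.normSq (z - x)).sum :=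
      Multiset.sum_nonneg fun y hy => by
        obtain ⟨x, -, rfl⟩ := Multiset.mem_map.1 hy
        exact one_div_nonneg.2 (Complex.normSq_nonneg _)
    have h7 : z.im * (1 + 1 / 2 * (P.roots.map fun x : ℝ => 1 / Complex.normSq (z - x)).sum) = 0 := by
      linarith
    rcases mul_eq_zero.1 h7 with h | h
    · exact hne h
    · linarith
  have hsplit : Q.Splits := by
    refine Splits.of_splits_map (algebraMap ℝ ℂ) (IsAlgClosed.splits _) fun z hz => ?_
    have hz' : aeval z Q = 0 := by
      have := (mem_roots'.1 hz).2
      rwa [IsRoot, eval_map_algebraMap] at this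
    exact ⟨z.re, Complex.ext (by simp) (by simp [hreal z hz'])⟩
  refine ⟨hmon, hsplit.natDegree_eq_card_roots.symm, ?_⟩
  rw [Multiset.nodup_iff_count_le_one]
  intro x
  rw [count_roots]
  by_contra! hlt
  obtain ⟨hr0, hr1⟩ := (one_lt_rootMultiplicity_iff_isRoot hmon.ne_zero).1 hlt
  have hL := laguerre_inequality P.roots x
  simp only [hP.prod_eq] at hL
  rw [IsRoot, hQ] at hr0 hr1
  simp only [smul_eq_C_mul, derivative_add, derivative_mul, derivative_sub, derivative_X,
    derivative_C, sub_zero, one_mul, zero_mul, zero_add, eval_add, eval_mul, eval_sub, eval_X,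
    eval_C] at hr0 hr1
  have hPx : P.eval x ≠ 0 := by
    -- a common zero of `P` and `P'` would be a multiple zero of `P`
    intro h0
    have h1 : (derivative P).eval x = 0 := by rw [h0] at hr0; linarith
    have h2 := (one_lt_rootMultiplicity_iff_isRoot hP.monic.ne_zero).2 ⟨h0, h1⟩
    have h3 := Multiset.nodup_iff_count_le_one.1 hP.nodup x
    rw [count_roots] at h3
    omega
  have hpos := sq_pos_of_ne_zero hPx
  have h8 : P.eval x * (P.eval x + (x - a) * (derivative P).eval x
      + -1 / 2 * (derivative (derivative P)).eval x) = 0 := by rw [hr1, mul_zero]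
  have h9 : P.eval x ^ 2 + 1 / 2 * ((derivative P).eval x ^ 2
      - P.eval x * (derivative (derivative P)).eval x) = 0 := by
    linear_combination h8 - (derivative P).eval x * hr0
  linarith

lemma hasSimpleRealRoots_heat_pow (a : ℝ) (n : ℕ) {R : ℝ[X]}
    (hR : HasSimpleRealRoots (heat (-1 / 2) R)) :
    HasSimpleRealRoots (heat (-1 / 2) ((X - C a) ^ n * R)) := by
  induction n with
  | zero => simpa using hR
  | succ n ih => rw [pow_succ', mul_assoc, heat_X_sub_C_mul]; exact ih.raising a

lemma hasSimpleRealRoots_heat_sourcePoly (a : ℝ) (n : ℕ) :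
    HasSimpleRealRoots (heat (-1 / 2) (sourcePoly a n)) := by
  rw [sourcePoly_eq]
  refine hasSimpleRealRoots_heat_pow _ _ (hasSimpleRealRoots_heat_pow _ _ ?_)
  rw [← mul_one ((X - C a) ^ n)]
  refine hasSimpleRealRoots_heat_pow _ _ ?_
  rw [heat_one]
  exact ⟨monic_one, by simp, by simp⟩

/-- The fourth-order differential equation of `H_{n,n,n}`. -/
lemma heat_sourcePoly_ode (a : ℝ) (n : ℕ) (z : ℂ) :
    let H := heat (-1 / 2) (sourcePoly a n)
    let H1 := derivative H
    let H2 := derivative H1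
    let H3 := derivative H2
    let H4 := derivative H3
    (z ^ 3 - 3 / 2 * z) * aeval z H1 - 3 / 2 * (z ^ 2 - 1 / 2) * aeval z H2
        + 3 / 4 * z * aeval z H3 - 1 / 8 * aeval z H4
        - a ^ 2 * (z * aeval z H1 - 1 / 2 * aeval z H2) =
      n * (3 * ((z ^ 2 - 1 / 2) * aeval z H - z * aeval z H1 + 1 / 4 * aeval z H2)
        - a ^ 2 * aeval z H) := by
  intro H H1 H2 H3 H4
  have h := heat_pow_ode (-1 / 2) (X ^ 3 - C (a ^ 2) * X) n
  have hd : derivative (X ^ 3 - C (a ^ 2) * X : ℝ[X]) = C 3 * X ^ 2 - C (a ^ 2) := by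
    rw [derivative_sub, derivative_X_pow, derivative_C_mul, derivative_X, mul_one]
    norm_num
  rw [hd] at h
  have h' := congrArg (aeval z) h
  change aeval z (aeval (raising (-1 / 2)) _ H1) = aeval z (_ * aeval (raising (-1 / 2)) _ H) at h'
  have e1 : derivative H = H1 := rfl
  have e2 : derivative H1 = H2 := rfl
  have e3 : derivative H2 = H3 := rfl
  have e4 : derivative H3 = H4 := rfl
  clear_value H1 H2 H3 H4 H
  simp only [map_sub, map_mul, aeval_X, aeval_C, LinearMap.sub_apply, Module.algebraMap_end_apply,
    Module.End.mul_apply, pow_succ, pow_zero, one_mul, raising_apply, smul_eq_C_mul,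
    derivative_mul, derivative_C, derivative_X, zero_mul, zero_add, map_add,
    map_natCast, Complex.coe_algebraMap, e1, e2, e3, e4] at h'
  push_cast at h'
  linear_combination h'

/-! ### Empirical measures and Cauchy transforms -/

/-- The normalized counting measure of a multiset of real numbers. -/
noncomputable def empiricalMeasure (m : Multiset ℝ) : Measure ℝ :=
  (Multiset.card m : ENNReal)⁻¹ • (m.map Measure.dirac).sum

lemma integral_sum_dirac {E : Type*} [NormedAddCommGroup E] [NormedSpace ℝ E]
    [CompleteSpace E] (m : Multiset ℝ) (f : ℝ → E) :
    Integrable f (m.map Measure.dirac).sum ∧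
      ∫ x, f x ∂(m.map Measure.dirac).sum = (m.map f).sum := by
  induction m using Multiset.induction with
  | empty => simp
  | cons a m ih =>
    have ha : Integrable f (Measure.dirac a) := integrable_dirac (by simp)
    simp only [Multiset.map_cons, Multiset.sum_cons]
    refine ⟨ha.add_measure ih.1, ?_⟩
    rw [integral_add_measure ha ih.1, ih.2, integral_dirac]

lemma isProbabilityMeasure_empiricalMeasure {m : Multiset ℝ} (hm : m ≠ 0) :
    IsProbabilityMeasure (empiricalMeasure m) := by
  have h : ∀ m : Multiset ℝ, (m.map Measure.dirac).sum Set.univ = (Multiset.card m : ENNReal) := by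
    intro m
    induction m using Multiset.induction with
    | empty => simp
    | cons a m ih => simp [ih, add_comm]
  refine ⟨?_⟩
  rw [empiricalMeasure, Measure.smul_apply, h, smul_eq_mul]
  exact ENNReal.inv_mul_cancel (by simpa using hm) (by simp)

lemma integral_empiricalMeasure {E : Type*} [NormedAddCommGroup E] [NormedSpace ℝ E]
    [CompleteSpace E] (m : Multiset ℝ) (f : ℝ → E) :
    ∫ x, f x ∂(empiricalMeasure m) = (Multiset.card m : ℝ)⁻¹ • (m.map f).sum := by
  rw [empiricalMeasure, integral_smul_measure, (integral_sum_dirac m f).2]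
  simp

/-- The Cauchy transform `z ↦ ∫ dμ(x) / (z - x)` of a measure on the line. -/
noncomputable def cauchyTransform (μ : Measure ℝ) (z : ℂ) : ℂ := ∫ x : ℝ, 1 / (z - x) ∂μ

lemma cauchyTransform_empiricalMeasure (m : Multiset ℝ) (z : ℂ) :
    cauchyTransform (empiricalMeasure m) z = (Multiset.card m : ℂ)⁻¹ * powerSumInv m 1 z := by
  rw [cauchyTransform, integral_empiricalMeasure, powerSumInv]
  simp

lemma norm_powerSumInv_le (m : Multiset ℝ) (j : ℕ) {z : ℂ} (hz : 0 < z.im) :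
    ‖powerSumInv m j z‖ ≤ Multiset.card m * (1 / z.im ^ j) := by
  induction m using Multiset.induction with
  | empty => simp [powerSumInv]
  | cons c m ih =>
    have h1 : ‖1 / (z - (c : ℂ)) ^ j‖ ≤ 1 / z.im ^ j := by
      rw [norm_div, norm_one, norm_pow]
      have h2 : z.im ≤ ‖z - (c : ℂ)‖ := by
        have := Complex.abs_im_le_norm (z - c)
        simp only [Complex.sub_im, Complex.ofReal_im, sub_zero] at this
        exact (le_abs_self _).trans this
      gcongr
    have h3 : powerSumInv (c ::ₘ m) j z = 1 / (z - c) ^ j + powerSumInv m j z := by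
      simp [powerSumInv]
    rw [h3, Multiset.card_cons]
    push_cast
    calc _ ≤ _ := norm_add_le _ _
      _ ≤ _ := by linarith

/-- The rescaled zeros `x / √n` of `H_{n,n,n}` for `c = 2 h √n`. -/
noncomputable def scaledZeros (h : ℝ) (n : ℕ) : Multiset ℝ :=
  (heat (-1 / 2) (sourcePoly (√n * h) n)).roots.map fun x => x / √n

lemma card_scaledZeros (h : ℝ) (n : ℕ) : Multiset.card (scaledZeros h n) = 3 * n := by
  rw [scaledZeros, Multiset.card_map, (hasSimpleRealRoots_heat_sourcePoly _ _).card,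
    (monic_heat (monic_sourcePoly _ _).1).2, (monic_sourcePoly _ _).2]

/-- The differential equation of `H_{n,n,n}`, in terms of the sums
`s_j = (1 / n) ∑ 1 / (z - y) ^ j` over the rescaled zeros `y`. -/
lemma scaledZeros_ode (h : ℝ) {n : ℕ} (hn : n ≠ 0) {z : ℂ} (hz : 0 < z.im) :
    let s := fun j => powerSumInv (scaledZeros h n) j z / n
    let u2 := s 1 ^ 2 - s 2 / n
    let u3 := s 1 ^ 3 - 3 * s 1 * (s 2 / n) + 2 * (s 3 / n ^ 2)
    let u4 := s 1 ^ 4 - 6 * s 1 ^ 2 * (s 2 / n) + 8 * s 1 * (s 3 / n ^ 2) + 3 * (s 2 / n) ^ 2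
      - 6 * (s 4 / n ^ 3)
    z ^ 3 * s 1 - 3 / 2 * z ^ 2 * u2 + 3 / 4 * z * u3 - 1 / 8 * u4 - h ^ 2 * (z * s 1 - 1 / 2 * u2)
      - (3 * (z ^ 2 - z * s 1 + 1 / 4 * u2) - h ^ 2)
      + 1 / n * (-(3 / 2) * z * s 1 + 3 / 4 * u2 + 3 / 2) = 0 := by
  intro s u2 u3 u4
  obtain ⟨r, hr, hrn⟩ : ∃ r : ℝ, 0 < r ∧ (n : ℝ) = r ^ 2 :=
    ⟨√n, Real.sqrt_pos.2 (by exact_mod_cast Nat.pos_of_ne_zero hn), (Real.sq_sqrt (by simp)).symm⟩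
  have hrs : √(n : ℝ) = r := by rw [hrn, Real.sqrt_sq hr.le]
  set H := heat (-1 / 2) (sourcePoly (r * h) n) with hH
  have hS := hasSimpleRealRoots_heat_sourcePoly (r * h) n
  rw [← hH] at hS
  have hr0 : (r : ℂ) ≠ 0 := by exact_mod_cast hr.ne'
  have hnC : (n : ℂ) = (r : ℂ) ^ 2 := by exact_mod_cast congrArg (fun t : ℝ => (t : ℂ)) hrn
  have hzx : ∀ x ∈ H.roots, (r : ℂ) * z ≠ (x : ℝ) := by
    intro x _ hx
    have := congrArg Complex.im hx
    simp [hr.ne', hz.ne'] at this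
  have hs : ∀ j, powerSumInv H.roots j (r * z) = r ^ 2 * s j / r ^ j := by
    intro j
    simp only [s, powerSumInv, scaledZeros, hrs, ← hH, hnC, Multiset.map_map, Function.comp_def]
    rw [mul_div_cancel₀ _ (pow_ne_zero 2 hr0), ← Multiset.sum_map_div]
    congr 1
    refine Multiset.map_congr rfl fun x hx => ?_
    have h1 : (r : ℂ) * z - x ≠ 0 := sub_ne_zero.2 (hzx x hx)
    have h2 : z - ((x / r : ℝ) : ℂ) = (r * z - x) / r := by push_cast; field_simp
    rw [h2, div_pow]
    field_simp
  obtain ⟨h0, h1, h2, h3, h4⟩ := aeval_derivatives_prod H.roots hzx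
  simp only [hS.prod_eq, hs] at h0 h1 h2 h3 h4
  have hode := heat_sourcePoly_ode (r * h) n (r * z)
  simp only [← hH, h1, h2, h3, h4, hnC] at hode
  have key : aeval ((r : ℂ) * z) H * r ^ 4 * (z ^ 3 * s 1 - 3 / 2 * z ^ 2 * u2 + 3 / 4 * z * u3
      - 1 / 8 * u4 - h ^ 2 * (z * s 1 - 1 / 2 * u2)
      - (3 * (z ^ 2 - z * s 1 + 1 / 4 * u2) - h ^ 2)
      + 1 / n * (-(3 / 2) * z * s 1 + 3 / 4 * u2 + 3 / 2)) = 0 := by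
    rw [← sub_eq_zero] at hode
    rw [← hode]
    simp only [u2, u3, u4, hnC]
    clear_value s
    push_cast
    field_simp
    ring
  exact (mul_eq_zero.1 key).resolve_left (mul_ne_zero h0 (pow_ne_zero 4 hr0))

/-- The normalized counting measure of the rescaled zeros of `H_{n+1,n+1,n+1}`. -/
noncomputable def zeroMeasure (h : ℝ) (n : ℕ) : Measure ℝ := empiricalMeasure (scaledZeros h (n + 1))

instance (h : ℝ) (n : ℕ) : IsProbabilityMeasure (zeroMeasure h n) :=
  isProbabilityMeasure_empiricalMeasure (Multiset.card_pos.1 (by rw [card_scaledZeros]; omega))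

/-- In the limit, the differential equation of `H_{n,n,n}` becomes an algebraic equation for the
Cauchy transform. -/
lemma algebraic_equation_of_tendsto (h : ℝ) {z g : ℂ} (hz : 0 < z.im) {l : Filter ℕ}
    [l.NeBot] (hl : l ≤ atTop)
    (hg : Tendsto (fun n => cauchyTransform (zeroMeasure h n) z) l (𝓝 g)) {w : ℂ}
    (hw : w = z - 3 / 2 * g) :
    2 * (z - w) * (w * (w ^ 2 - h ^ 2)) = 3 * w ^ 2 - h ^ 2 := by
  set s : ℕ → ℕ → ℂ := fun j n => powerSumInv (scaledZeros h (n + 1)) j z / ((n + 1 : ℕ) : ℂ)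
    with hs
  have hs1 : Tendsto (s 1) l (𝓝 (3 * g)) := by
    refine (hg.const_mul 3).congr fun n => ?_
    have : ((n + 1 : ℕ) : ℂ) ≠ 0 := by exact_mod_cast n.succ_ne_zero
    rw [zeroMeasure, cauchyTransform_empiricalMeasure, card_scaledZeros, hs]
    push_cast at this ⊢
    field_simp
  have hinv : Tendsto (fun n : ℕ => 1 / ((n + 1 : ℕ) : ℂ)) l (𝓝 0) := by
    refine Tendsto.mono_left ?_ hl
    have := tendsto_one_div_add_atTop_nhds_zero_nat (𝕜 := ℂ)
    simpa using this
  have hsj : ∀ j k, Tendsto (fun n => s j n / ((n + 1 : ℕ) : ℂ) ^ (k + 1)) l (𝓝 0) := by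
    intro j k
    have h1 : Tendsto (fun n : ℕ => (1 / ((n + 1 : ℕ) : ℂ)) ^ (k + 1)) l (𝓝 0) := by
      simpa using hinv.pow (k + 1)
    refine (h1.zero_mul_isBoundedUnder_le (g := s j) ?_).congr fun n => ?_
    · refine isBoundedUnder_of ⟨3 * (1 / z.im ^ j), fun n => ?_⟩
      have h2 := norm_powerSumInv_le (scaledZeros h (n + 1)) j hz
      have h3 : (0 : ℝ) < ((n + 1 : ℕ) : ℝ) := by exact_mod_cast n.succ_pos
      rw [card_scaledZeros] at h2
      simp only [Function.comp_apply, hs, norm_div, Complex.norm_natCast]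
      rw [div_le_iff₀ h3]
      refine h2.trans_eq ?_
      push_cast; ring
    · rw [div_pow, one_pow]; ring
  have h2 := hsj 2 0
  have h3 := hsj 3 1
  have h4 := hsj 4 2
  simp only [zero_add, pow_one, Nat.reduceAdd] at h2 h3 h4
  have hu2 := (hs1.pow 2).sub h2
  have hu3 := ((hs1.pow 3).sub ((hs1.const_mul 3).mul h2)).add (h3.const_mul 2)
  have hu4 := (((((hs1.pow 4).sub (((hs1.pow 2).const_mul 6).mul h2))).add
    ((hs1.const_mul 8).mul h3)).add ((h2.pow 2).const_mul 3)).sub (h4.const_mul 6)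
  have htot := ((((((hs1.const_mul (z ^ 3)).sub (hu2.const_mul (3 / 2 * z ^ 2))).add
    (hu3.const_mul (3 / 4 * z))).sub (hu4.const_mul (1 / 8))).sub
    (((hs1.const_mul z).sub (hu2.const_mul (1 / 2))).const_mul ((h : ℂ) ^ 2))).sub
    ((((tendsto_const_nhds (x := z ^ 2)).sub (hs1.const_mul z)).add
      (hu2.const_mul (1 / 4))).const_mul 3 |>.sub
      (tendsto_const_nhds (x := (h : ℂ) ^ 2)))).add
    (hinv.mul (((hs1.const_mul (-(3 / 2) * z)).add (hu2.const_mul (3 / 4))).add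
      (tendsto_const_nhds (x := (3 / 2 : ℂ)))))
  have h0 := tendsto_nhds_unique (htot.congr fun n => scaledZeros_ode h n.succ_ne_zero hz)
    tendsto_const_nhds
  rw [hw]
  linear_combination h0

/-! ### The map `ψ(w) = w + (1/2) ∑ 1 / (w - a)` -/

/-- The map `ψ(w) = w + (1/2) (1 / (w + h) + 1 / w + 1 / (w - h))`. The subordination function of
the limiting zero distribution is a right inverse of it. -/
noncomputable def sourceMap (h : ℝ) (w : ℂ) : ℂ := w + 1 / 2 * (1 / (w + h) + 1 / w + 1 / (w - h))

/-- The function `(1/2) (1 / |w + h|² + 1 / |w|² + 1 / |w - h|²)`, which equals `1 - ψ'(w)` for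
real `w`. -/
noncomputable def sourceSum (h : ℝ) (w : ℂ) : ℝ :=
  1 / 2 * (1 / Complex.normSq (w + h) + 1 / Complex.normSq w + 1 / Complex.normSq (w - h))

/-- `w` is not one of the poles `-h`, `0`, `h` of `sourceMap h`. -/
def OffPoles (h : ℝ) (w : ℂ) : Prop := w + h ≠ 0 ∧ w ≠ 0 ∧ w - h ≠ 0

lemma offPoles_of_im_pos (h : ℝ) {w : ℂ} (hw : 0 < w.im) : OffPoles h w := by
  refine ⟨fun h0 => ?_, fun h0 => ?_, fun h0 => ?_⟩ <;>
  · have := congrArg Complex.im h0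
    simp at this
    exact hw.ne' this

lemma sourceMap_im (h : ℝ) (w : ℂ) : (sourceMap h w).im = w.im * (1 - sourceSum h w) := by
  have h1 : (1 / 2 : ℂ) = ((1 / 2 : ℝ) : ℂ) := by push_cast; ring
  rw [sourceMap, sourceSum, Complex.add_im, h1, Complex.im_ofReal_mul]
  simp only [one_div, Complex.add_im, Complex.inv_im, Complex.ofReal_im, Complex.sub_im]
  ring

lemma norm_one_div_le (u : ℂ) : ‖1 / u‖ ≤ 1 / 2 + 1 / 2 * (1 / Complex.normSq u) := by
  have h1 : 1 / Complex.normSq u = ‖1 / u‖ ^ 2 := by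
    rw [Complex.normSq_eq_norm_sq, norm_div, norm_one, div_pow, one_pow]
  rw [h1]
  nlinarith [sq_nonneg (‖1 / u‖ - 1)]

lemma norm_sub_sourceMap_le (h : ℝ) (w : ℂ) :
    ‖sourceMap h w - w‖ ≤ 3 / 4 + 1 / 2 * sourceSum h w := by
  have h1 : sourceMap h w - w = 1 / 2 * (1 / (w + h) + 1 / w + 1 / (w - h)) := by
    rw [sourceMap]; ring
  have h2 : ‖(1 / 2 : ℂ)‖ = 1 / 2 := by simp
  rw [h1, norm_mul, h2, sourceSum]
  have := norm_add₃_le (a := 1 / (w + h)) (b := 1 / w) (c := 1 / (w - h))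
  have := norm_one_div_le (w + h)
  have := norm_one_div_le w
  have := norm_one_div_le (w - h)
  linarith

lemma norm_one_div_mul_le (u v : ℂ) :
    ‖1 / (u * v)‖ ≤ 1 / 2 * (1 / Complex.normSq u + 1 / Complex.normSq v) := by
  have h1 : ∀ u : ℂ, 1 / Complex.normSq u = ‖1 / u‖ ^ 2 := fun u => by
    rw [Complex.normSq_eq_norm_sq, norm_div, norm_one, div_pow, one_pow]
  have h2 : (1 : ℂ) / (u * v) = 1 / u * (1 / v) := by rw [one_div_mul_one_div]
  rw [h1, h1, h2, norm_mul]
  nlinarith [sq_nonneg (‖1 / u‖ - ‖1 / v‖)]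

/-- Divided differences of `ψ` are bounded below where `sourceSum` is below `1`: by the
arithmetic-geometric mean inequality,
`(ψ(w₁) - ψ(w₂)) / (w₁ - w₂) = 1 - (1/2) ∑ 1 / ((w₁ - a) (w₂ - a))` stays away from `0`. -/
lemma norm_sub_mul_le_norm_sourceMap_sub {h : ℝ} {w₁ w₂ : ℂ} (h₁ : OffPoles h w₁)
    (h₂ : OffPoles h w₂) :
    ‖w₁ - w₂‖ * (1 - (sourceSum h w₁ + sourceSum h w₂) / 2) ≤
      ‖sourceMap h w₁ - sourceMap h w₂‖ := by
  set K : ℂ := 1 / 2 * (1 / ((w₁ + h) * (w₂ + h)) + 1 / (w₁ * w₂) + 1 / ((w₁ - h) * (w₂ - h)))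
    with hK
  have hsub : sourceMap h w₁ - sourceMap h w₂ = (w₁ - w₂) * (1 - K) := by
    obtain ⟨a1, a2, a3⟩ := h₁
    obtain ⟨b1, b2, b3⟩ := h₂
    rw [hK, sourceMap, sourceMap]
    field_simp
    ring
  have hKn : ‖K‖ ≤ (sourceSum h w₁ + sourceSum h w₂) / 2 := by
    have h2 : ‖(1 / 2 : ℂ)‖ = 1 / 2 := by simp
    rw [hK, norm_mul, h2, sourceSum, sourceSum]
    have := norm_add₃_le (a := 1 / ((w₁ + h) * (w₂ + h))) (b := 1 / (w₁ * w₂))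
      (c := 1 / ((w₁ - h) * (w₂ - h)))
    have := norm_one_div_mul_le (w₁ + h) (w₂ + h)
    have := norm_one_div_mul_le w₁ w₂
    have := norm_one_div_mul_le (w₁ - h) (w₂ - h)
    linarith
  rw [hsub, norm_mul]
  refine mul_le_mul_of_nonneg_left ?_ (norm_nonneg _)
  have := norm_sub_norm_le (1 : ℂ) K
  rw [norm_one] at this
  linarith

lemma sourceSum_lt_one {h : ℝ} {w : ℂ} (hw : 0 < w.im) (hz : 0 < (sourceMap h w).im) :
    sourceSum h w < 1 := by
  rw [sourceMap_im] at hz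
  linarith [(pos_iff_pos_of_mul_pos hz).1 hw]

/-- `ψ` is injective on the set of `w` in the upper half-plane whose image is in the upper
half-plane. -/
lemma sourceMap_injective {h : ℝ} {w₁ w₂ z : ℂ} (hz : 0 < z.im) (h₁ : 0 < w₁.im)
    (h₂ : 0 < w₂.im) (e₁ : sourceMap h w₁ = z) (e₂ : sourceMap h w₂ = z) : w₁ = w₂ := by
  have s₁ := sourceSum_lt_one (h := h) h₁ (by rwa [e₁])
  have s₂ := sourceSum_lt_one (h := h) h₂ (by rwa [e₂])
  have := norm_sub_mul_le_norm_sourceMap_sub (offPoles_of_im_pos h h₁) (offPoles_of_im_pos h h₂)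
  rw [e₁, e₂, sub_self, norm_zero] at this
  have h0 : ‖w₁ - w₂‖ ≤ 0 := by
    by_contra! hpos
    nlinarith
  exact sub_eq_zero.1 (norm_le_zero_iff.1 h0)

lemma sourceMap_eq_of_algebraic {h : ℝ} {w z : ℂ} (hw : OffPoles h w)
    (e : 2 * (z - w) * (w * (w ^ 2 - h ^ 2)) = 3 * w ^ 2 - h ^ 2) : sourceMap h w = z := by
  obtain ⟨a1, a2, a3⟩ := hw
  rw [sourceMap]
  field_simp
  linear_combination -e

/-! ### Cauchy transforms of probability measures -/

lemma sub_ofReal_ne_zero {z : ℂ} (hz : 0 < z.im) (x : ℝ) : z - x ≠ 0 := by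
  intro h0
  have := congrArg Complex.im h0
  simp at this
  exact hz.ne' this

lemma im_le_norm_sub_ofReal (z : ℂ) (x : ℝ) : z.im ≤ ‖z - x‖ := by
  have := Complex.abs_im_le_norm (z - x)
  simp only [Complex.sub_im, Complex.ofReal_im, sub_zero] at this
  exact (le_abs_self _).trans this

/-- The bounded continuous function `x ↦ 1 / (z - x)` for `z` in the upper half-plane. -/
noncomputable def cauchyKernel (z : ℂ) (hz : 0 < z.im) : ℝ →ᵇ ℂ :=
  BoundedContinuousFunction.ofNormedAddCommGroup (fun x : ℝ => 1 / (z - x))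
    (continuous_const.div (continuous_const.sub Complex.continuous_ofReal)
      (sub_ofReal_ne_zero hz)) (1 / z.im) fun x => by
    rw [norm_div, norm_one]
    exact one_div_le_one_div_of_le hz (im_le_norm_sub_ofReal z x)

lemma integrable_cauchyKernel (μ : Measure ℝ) [IsFiniteMeasure μ] {z : ℂ} (hz : 0 < z.im) :
    Integrable (fun x : ℝ => 1 / (z - x)) μ :=
  (cauchyKernel z hz).integrable μ

lemma norm_cauchyTransform_le (μ : Measure ℝ) [IsProbabilityMeasure μ] {z : ℂ} (hz : 0 < z.im) :
    ‖cauchyTransform μ z‖ ≤ 1 / z.im := by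
  have := norm_integral_le_of_norm_le_const (μ := μ) (f := fun x : ℝ => 1 / (z - x))
    (C := 1 / z.im) (ae_of_all _ fun x => by
      rw [norm_div, norm_one]
      exact one_div_le_one_div_of_le hz (im_le_norm_sub_ofReal z x))
  simpa [cauchyTransform] using this

lemma im_cauchyTransform (μ : Measure ℝ) [IsFiniteMeasure μ] {z : ℂ} (hz : 0 < z.im) :
    Integrable (fun x : ℝ => z.im / Complex.normSq (z - x)) μ ∧
    (cauchyTransform μ z).im = -∫ x : ℝ, z.im / Complex.normSq (z - x) ∂μ := by
  have h1 := integrable_cauchyKernel μ hz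
  have h2 : ∀ x : ℝ, (1 / (z - x)).im = -(z.im / Complex.normSq (z - x)) := by
    intro x; simp [Complex.inv_im, neg_div]
  have h3 : Integrable (fun x : ℝ => (1 / (z - x)).im) μ := h1.im
  constructor
  · refine h3.neg.congr (ae_of_all _ fun x => ?_)
    simp only [Pi.neg_apply, h2, neg_neg]
  · rw [cauchyTransform, ← integral_neg]
    simp_rw [← h2]
    exact (integral_im h1).symm

lemma im_cauchyTransform_nonpos (μ : Measure ℝ) [IsFiniteMeasure μ] {z : ℂ} (hz : 0 < z.im) :
    (cauchyTransform μ z).im ≤ 0 := by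
  rw [(im_cauchyTransform μ hz).2, neg_nonpos]
  exact integral_nonneg fun x => div_nonneg hz.le (Complex.normSq_nonneg _)

lemma normSq_mk_sub (x y t : ℝ) : Complex.normSq (⟨x, y⟩ - (t : ℂ)) = (x - t) ^ 2 + y ^ 2 := by
  simp [Complex.normSq_apply]; ring

/-- The mass of a ball is controlled by the imaginary part of the Cauchy transform above its
centre. -/
lemma measureReal_closedBall_le (μ : Measure ℝ) [IsFiniteMeasure μ] (x : ℝ) {y : ℝ} (hy : 0 < y) :
    μ.real (Metric.closedBall x y) ≤ 2 * y * -(cauchyTransform μ ⟨x, y⟩).im := by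
  obtain ⟨h1, h2⟩ := im_cauchyTransform μ (z := ⟨x, y⟩) hy
  have h3 : μ.real (Metric.closedBall x y) * (1 / (2 * y)) ≤
      ∫ t : ℝ, y / Complex.normSq (⟨x, y⟩ - (t : ℂ)) ∂μ := by
    rw [← smul_eq_mul, ← setIntegral_const]
    refine (setIntegral_mono_on (integrable_const _).integrableOn h1.integrableOn
      measurableSet_closedBall fun t ht => ?_).trans
      (setIntegral_le_integral h1 (ae_of_all _ fun t => div_nonneg hy.le (Complex.normSq_nonneg _)))
    rw [normSq_mk_sub]
    rw [Metric.mem_closedBall, Real.dist_eq, abs_sub_comm] at ht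
    have h4 : (x - t) ^ 2 ≤ y ^ 2 := sq_le_sq' (by linarith [neg_abs_le (x - t)])
      ((le_abs_self _).trans ht)
    rw [div_le_div_iff₀ (by positivity) (by positivity)]
    nlinarith
  rw [h2, neg_neg]
  calc _ = 2 * y * (μ.real (Metric.closedBall x y) * (1 / (2 * y))) := by field_simp
    _ ≤ _ := by gcongr

/-- The tails of a measure are controlled by its Cauchy transform on the imaginary axis. -/
lemma measureReal_tail_le (μ : Measure ℝ) [IsProbabilityMeasure μ] {r : ℝ} (hr : 0 < r) :
    μ.real {x : ℝ | r < ‖x‖} ≤ 2 * (1 - ((⟨0, r⟩ : ℂ) * cauchyTransform μ ⟨0, r⟩)).re := by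
  obtain ⟨h1, h2⟩ := im_cauchyTransform μ (z := ⟨0, r⟩) hr
  have h3 : (1 - ((⟨0, r⟩ : ℂ) * cauchyTransform μ ⟨0, r⟩)).re =
      ∫ t : ℝ, (1 - r * (r / Complex.normSq (⟨0, r⟩ - (t : ℂ)))) ∂μ := by
    rw [integral_sub (integrable_const _) (h1.const_mul r), integral_const_mul, Complex.sub_re,
      Complex.mul_re, h2]
    simp
  have h4 : ∀ t : ℝ, 1 - r * (r / Complex.normSq (⟨0, r⟩ - (t : ℂ))) = t ^ 2 / (t ^ 2 + r ^ 2) := by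
    intro t
    rw [normSq_mk_sub, zero_sub, neg_sq]
    have : t ^ 2 + r ^ 2 ≠ 0 := by positivity
    field_simp
    ring
  have h5 : Integrable (fun t : ℝ => t ^ 2 / (t ^ 2 + r ^ 2)) μ := by
    simp_rw [← h4]
    exact (integrable_const _).sub (h1.const_mul r)
  simp_rw [h4] at h3
  have h6 := mul_meas_ge_le_integral_of_nonneg (μ := μ) (ae_of_all _ fun t => by positivity) h5
    (1 / 2)
  have h7 : μ.real {x : ℝ | r < ‖x‖} ≤ μ.real {x : ℝ | 1 / 2 ≤ x ^ 2 / (x ^ 2 + r ^ 2)} := by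
    refine measureReal_mono fun t ht => ?_
    have ht : r < |t| := ht
    have : r ^ 2 < t ^ 2 := by rw [← sq_abs t]; gcongr
    change 1 / 2 ≤ t ^ 2 / (t ^ 2 + r ^ 2)
    rw [div_le_div_iff₀ (by norm_num) (by positivity)]
    linarith
  rw [h3]
  linarith

/-! ### A measure is determined by its Cauchy transform -/

lemma integrable_poissonKernel (s : ℝ) {y : ℝ} (hy : 0 < y) :
    Integrable fun x : ℝ => y / ((x - s) ^ 2 + y ^ 2) := by
  have h := ((integrable_inv_one_add_sq.comp_div hy.ne').comp_sub_right s).const_mul y⁻¹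
  refine h.congr (ae_of_all _ fun x => ?_)
  have : (x - s) ^ 2 + y ^ 2 ≠ 0 := by positivity
  have : y ^ 2 + (x - s) ^ 2 ≠ 0 := by positivity
  simp only
  field_simp
  ring

lemma integral_mul_poissonKernel (F : ℝ → ℝ) (s : ℝ) {y : ℝ} (hy : 0 < y) :
    ∫ x : ℝ, F x * (y / ((x - s) ^ 2 + y ^ 2)) = ∫ t : ℝ, F (s + y * t) * (1 + t ^ 2)⁻¹ := by
  have h1 := integral_add_right_eq_self (μ := volume)
    (fun x : ℝ => F x * (y / ((x - s) ^ 2 + y ^ 2))) s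
  have h2 := Measure.integral_comp_mul_left
    (fun x : ℝ => F (x + s) * (y / ((x + s - s) ^ 2 + y ^ 2))) y
  rw [h1, abs_of_pos (inv_pos.2 hy), smul_eq_mul] at h2
  rw [eq_comm, inv_mul_eq_iff_eq_mul₀ hy.ne', ← integral_const_mul] at h2
  rw [h2]
  refine integral_congr_ae (ae_of_all _ fun t => ?_)
  have : (y * t) ^ 2 + y ^ 2 ≠ 0 := by positivity
  have : 1 + t ^ 2 ≠ 0 := by positivity
  simp only [add_sub_cancel_right]
  rw [add_comm s]
  field_simp
  ring

/-- The Poisson integral of a measure is the imaginary part of its Cauchy transform. -/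
lemma integral_mul_im_cauchyTransform (μ : Measure ℝ) [IsProbabilityMeasure μ] (f : ℝ →ᵇ ℝ)
    {y : ℝ} (hy : 0 < y) :
    ∫ x : ℝ, f x * -(cauchyTransform μ ⟨x, y⟩).im =
      ∫ p : ℝ × ℝ, f (p.1 + y * p.2) * (1 + p.2 ^ 2)⁻¹ ∂(μ.prod volume) := by
  have hpos : ∀ s x : ℝ, 0 < (x - s) ^ 2 + y ^ 2 := fun s x => by positivity
  have hcont : Continuous fun p : ℝ × ℝ => f p.2 * (y / ((p.2 - p.1) ^ 2 + y ^ 2)) := by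
    have := fun p : ℝ × ℝ => (hpos p.1 p.2).ne'
    fun_prop (disch := assumption)
  have hle : ∀ s x : ℝ, ‖f x * (y / ((x - s) ^ 2 + y ^ 2))‖ ≤
      ‖f‖ * (y / ((x - s) ^ 2 + y ^ 2)) := by
    intro s x
    have h0 : 0 ≤ y / ((x - s) ^ 2 + y ^ 2) := div_nonneg hy.le (hpos s x).le
    rw [norm_mul, Real.norm_of_nonneg h0]
    exact mul_le_mul_of_nonneg_right (f.norm_coe_le_norm x) h0
  have hint1 : ∀ s : ℝ, Integrable fun x : ℝ => f x * (y / ((x - s) ^ 2 + y ^ 2)) := fun s =>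
    ((integrable_poissonKernel s hy).const_mul ‖f‖).mono'
      (hcont.comp (Continuous.prodMk_right s)).aestronglyMeasurable (ae_of_all _ (hle s))
  have hint : Integrable (fun p : ℝ × ℝ => f p.2 * (y / ((p.2 - p.1) ^ 2 + y ^ 2)))
      (μ.prod volume) := by
    rw [integrable_prod_iff hcont.aestronglyMeasurable]
    refine ⟨ae_of_all _ hint1, ?_⟩
    refine (integrable_const (‖f‖ * Real.pi)).mono'
      hcont.aestronglyMeasurable.norm.integral_prod_right' (ae_of_all _ fun s => ?_)
    rw [Real.norm_of_nonneg (integral_nonneg fun x => norm_nonneg _)]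
    refine (integral_mono (hint1 s).norm ((integrable_poissonKernel s hy).const_mul ‖f‖)
      (hle s)).trans_eq ?_
    rw [integral_const_mul]
    have := integral_mul_poissonKernel (fun _ => 1) s hy
    simp only [one_mul, integral_univ_inv_one_add_sq] at this
    rw [this]
  have hint2 : Integrable (fun p : ℝ × ℝ => f (p.1 + y * p.2) * (1 + p.2 ^ 2)⁻¹)
      (μ.prod volume) := by
    have h1 : Integrable (fun p : ℝ × ℝ => ‖f‖ * (1 + p.2 ^ 2)⁻¹) (μ.prod volume) :=
      (integrable_const (μ := μ) ‖f‖).mul_prod integrable_inv_one_add_sq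
    have h2 : ∀ p : ℝ × ℝ, 1 + p.2 ^ 2 ≠ 0 := fun p => by positivity
    have h3 : Continuous fun p : ℝ × ℝ => f (p.1 + y * p.2) * (1 + p.2 ^ 2)⁻¹ := by
      fun_prop (disch := assumption)
    refine h1.mono' h3.aestronglyMeasurable (ae_of_all _ fun p => ?_)
    rw [norm_mul, Real.norm_of_nonneg (by positivity : (0 : ℝ) ≤ (1 + p.2 ^ 2)⁻¹)]
    gcongr
    exact f.norm_coe_le_norm _
  rw [integral_prod _ hint2]
  simp_rw [← integral_mul_poissonKernel f _ hy]
  rw [integral_integral_swap hint]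
  refine integral_congr_ae (ae_of_all _ fun x => ?_)
  simp only
  rw [integral_const_mul, (im_cauchyTransform μ (z := ⟨x, y⟩) hy).2, neg_neg]
  simp_rw [normSq_mk_sub]

/-- Stieltjes inversion: the Poisson integrals of a measure converge weakly to it. -/
lemma tendsto_integral_mul_im_cauchyTransform (μ : Measure ℝ) [IsProbabilityMeasure μ]
    (f : ℝ →ᵇ ℝ) :
    Tendsto (fun y : ℝ => ∫ x : ℝ, f x * -(cauchyTransform μ ⟨x, y⟩).im) (𝓝[>] 0)
      (𝓝 ((∫ x, f x ∂μ) * Real.pi)) := by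
  have h1 : ∫ p : ℝ × ℝ, f p.1 * (1 + p.2 ^ 2)⁻¹ ∂(μ.prod volume) = (∫ x, f x ∂μ) * Real.pi := by
    rw [integral_prod_mul (fun x => f x) fun t : ℝ => (1 + t ^ 2)⁻¹, integral_univ_inv_one_add_sq]
  rw [← h1]
  refine Tendsto.congr' (f₁ := fun y : ℝ =>
    ∫ p : ℝ × ℝ, f (p.1 + y * p.2) * (1 + p.2 ^ 2)⁻¹ ∂(μ.prod volume)) ?_ ?_
  · filter_upwards [self_mem_nhdsWithin] with y hy
    exact (integral_mul_im_cauchyTransform μ f hy).symm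
  · have h2 : ∀ p : ℝ × ℝ, 1 + p.2 ^ 2 ≠ 0 := fun p => by positivity
    refine tendsto_integral_filter_of_dominated_convergence
      (fun p : ℝ × ℝ => ‖f‖ * (1 + p.2 ^ 2)⁻¹) ?_ ?_ ?_ ?_
    · refine Eventually.of_forall fun y => Continuous.aestronglyMeasurable ?_
      fun_prop (disch := assumption)
    · refine Eventually.of_forall fun y => ae_of_all _ fun p => ?_
      rw [norm_mul, Real.norm_of_nonneg (by positivity : (0 : ℝ) ≤ (1 + p.2 ^ 2)⁻¹)]
      gcongr
      exact f.norm_coe_le_norm _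
    · exact (integrable_const (μ := μ) ‖f‖).mul_prod integrable_inv_one_add_sq
    · refine ae_of_all _ fun p => Tendsto.mul_const _ ?_
      have h3 : Continuous fun y : ℝ => f (p.1 + y * p.2) := by fun_prop
      have h4 := h3.tendsto 0
      simp only [zero_mul, add_zero] at h4
      exact h4.mono_left nhdsWithin_le_nhds

lemma eq_of_cauchyTransform_eq {μ ν : Measure ℝ} [IsProbabilityMeasure μ] [IsProbabilityMeasure ν]
    (h : ∀ z : ℂ, 0 < z.im → cauchyTransform μ z = cauchyTransform ν z) : μ = ν := by
  refine ext_of_forall_integral_eq_of_IsFiniteMeasure fun f => ?_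
  have h1 := tendsto_integral_mul_im_cauchyTransform μ f
  have h2 := tendsto_integral_mul_im_cauchyTransform ν f
  refine mul_right_cancel₀ Real.pi_ne_zero (tendsto_nhds_unique (h1.congr' ?_) h2)
  filter_upwards [self_mem_nhdsWithin] with y hy
  exact integral_congr_ae (ae_of_all _ fun x => by simp only [h ⟨x, y⟩ hy])

/-! ### Weak convergence of the zero distributions -/

/-- The functional equation `ψ(z - (3/2) G(z)) = z` for the Cauchy transform `G` of the limiting
zero distribution. It characterizes the free convolution of the uniform distribution on
`{-h, 0, h}` with a semicircle law of variance `3/2`. -/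
def SolvesSourceEquation (h : ℝ) (μ : Measure ℝ) : Prop :=
  ∀ z : ℂ, 0 < z.im → sourceMap h (z - 3 / 2 * cauchyTransform μ z) = z

lemma im_le_im_sub (z : ℂ) {g : ℂ} (hg : g.im ≤ 0) : z.im ≤ (z - 3 / 2 * g).im := by
  have h1 : (3 / 2 : ℂ) = ((3 / 2 : ℝ) : ℂ) := by push_cast; ring
  rw [Complex.sub_im, h1, Complex.im_ofReal_mul]
  linarith

lemma im_le_im_subordination (μ : Measure ℝ) [IsFiniteMeasure μ] {z : ℂ} (hz : 0 < z.im) :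
    z.im ≤ (z - 3 / 2 * cauchyTransform μ z).im :=
  im_le_im_sub z (im_cauchyTransform_nonpos μ hz)

/-- A probability measure is determined by the functional equation. -/
lemma SolvesSourceEquation.unique {h : ℝ} {μ ν : Measure ℝ} [IsProbabilityMeasure μ]
    [IsProbabilityMeasure ν] (hμ : SolvesSourceEquation h μ) (hν : SolvesSourceEquation h ν) :
    μ = ν := by
  refine eq_of_cauchyTransform_eq fun z hz => ?_
  have := sourceMap_injective hz (hz.trans_le (im_le_im_subordination μ hz))
    (hz.trans_le (im_le_im_subordination ν hz)) (hμ z hz) (hν z hz)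
  linear_combination (-2 / 3) * this

/-- Limit points of the Cauchy transforms of the zero measures solve the functional equation. -/
lemma sourceMap_of_tendsto (h : ℝ) {z g : ℂ} (hz : 0 < z.im) {l : Filter ℕ}
    [l.NeBot] (hl : l ≤ atTop)
    (hg : Tendsto (fun n => cauchyTransform (zeroMeasure h n) z) l (𝓝 g)) :
    g.im ≤ 0 ∧ sourceMap h (z - 3 / 2 * g) = z := by
  have h1 : g.im ≤ 0 := le_of_tendsto ((Complex.continuous_im.tendsto g).comp hg)
    (Eventually.of_forall fun n => im_cauchyTransform_nonpos _ hz)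
  refine ⟨h1, sourceMap_eq_of_algebraic
    (offPoles_of_im_pos h (hz.trans_le (im_le_im_sub z h1)))
    (algebraic_equation_of_tendsto h hz hl hg rfl)⟩

lemma exists_tendsto_cauchyTransform (h : ℝ) {z : ℂ} (hz : 0 < z.im) :
    ∃ g : ℂ, Tendsto (fun n => cauchyTransform (zeroMeasure h n) z) atTop (𝓝 g) := by
  have hK := isCompact_closedBall (0 : ℂ) (1 / z.im)
  have hmem : ∀ n, cauchyTransform (zeroMeasure h n) z ∈ Metric.closedBall (0 : ℂ) (1 / z.im) :=
    fun n => by simpa using norm_cauchyTransform_le (zeroMeasure h n) hz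
  have hlim : ∀ U : Ultrafilter ℕ, (U : Filter ℕ) ≤ atTop →
      ∃ g : ℂ, Tendsto (fun n => cauchyTransform (zeroMeasure h n) z) U (𝓝 g) := by
    intro U hU
    obtain ⟨g, -, hg⟩ := hK.ultrafilter_le_nhds (U.map fun n => cauchyTransform (zeroMeasure h n) z)
      (by
        rw [Ultrafilter.coe_map, le_principal_iff, mem_map]
        exact Eventually.of_forall hmem)
    exact ⟨g, hg⟩
  obtain ⟨g, hg⟩ := hlim (Ultrafilter.of atTop) (Ultrafilter.of_le _)
  refine ⟨g, (tendsto_iff_ultrafilter _ _ _).2 fun U hU => ?_⟩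
  obtain ⟨g', hg'⟩ := hlim U hU
  obtain ⟨i1, e1⟩ := sourceMap_of_tendsto h hz (Ultrafilter.of_le _) hg
  obtain ⟨i2, e2⟩ := sourceMap_of_tendsto h hz hU hg'
  have := sourceMap_injective hz (hz.trans_le (im_le_im_sub z i1))
    (hz.trans_le (im_le_im_sub z i2)) e1 e2
  have h2 : g = g' := by linear_combination (-2 / 3) * this
  rwa [h2]

/-- Solutions of the functional equation behave like `1 / z` on the imaginary axis. -/
lemma norm_one_sub_mul_le {h : ℝ} (hh : 0 < h) {z g : ℂ} (hz : 0 < z.im) (hg : g.im ≤ 0)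
    (e : sourceMap h (z - 3 / 2 * g) = z) : ‖1 - z * g‖ ≤ (5 / 4 + h) / z.im := by
  set w := z - 3 / 2 * g with hw
  have hwim : z.im ≤ w.im := im_le_im_sub z hg
  have hwpos := hz.trans_le hwim
  have hS := sourceSum_lt_one (h := h) hwpos (by rwa [e])
  have h1 : ‖z - w‖ ≤ 5 / 4 := by
    have := norm_sub_sourceMap_le h w
    rw [e] at this
    linarith
  have hterm : ∀ a : ℝ, |a| ≤ h → ‖(w - a - z) / (w - a)‖ ≤ (5 / 4 + h) / z.im := by
    intro a ha
    have h2 : z.im ≤ ‖w - a‖ := hwim.trans (im_le_norm_sub_ofReal w a)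
    have h3 : ‖w - a - z‖ ≤ 5 / 4 + h := by
      have h4 : w - a - z = -(z - w) - a := by ring
      rw [h4]
      refine (norm_sub_le _ _).trans ?_
      rw [norm_neg, Complex.norm_real, Real.norm_eq_abs]
      linarith
    rw [norm_div]
    gcongr
  obtain ⟨a1, a2, a3⟩ := offPoles_of_im_pos h hwpos
  have h5 : 1 - z * g = 1 / 3 * ((w - (-h : ℝ) - z) / (w - (-h : ℝ)) + (w - (0 : ℝ) - z) / (w - (0 : ℝ))
      + (w - h - z) / (w - h)) := by
    have h6 : g = 2 / 3 * (sourceMap h w - w) := by rw [e, hw]; ring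
    have h7 : w + (h : ℂ) ≠ 0 := a1
    rw [h6, sourceMap]
    push_cast
    rw [sub_neg_eq_add, sub_zero]
    field_simp
    ring
  rw [h5, norm_mul]
  have h8 : ‖(1 / 3 : ℂ)‖ = 1 / 3 := by simp
  rw [h8]
  have := norm_add₃_le (a := (w - (-h : ℝ) - z) / (w - (-h : ℝ)))
    (b := (w - (0 : ℝ) - z) / (w - (0 : ℝ))) (c := (w - h - z) / (w - h))
  have := hterm (-h) (by rw [abs_neg, abs_of_pos hh])
  have := hterm 0 (by rw [abs_zero]; exact hh.le)
  have := hterm h (by rw [abs_of_pos hh])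
  linarith

lemma isTightMeasureSet_zeroMeasure {h : ℝ} (hh : 0 < h) :
    IsTightMeasureSet (Set.range (zeroMeasure h)) := by
  refine isTightMeasureSet_range_of_tendsto_limsup_measure_norm_gt ?_
  have hbound : ∀ r : ℝ, 0 < r →
      limsup (fun n => zeroMeasure h n {x | r < ‖x‖}) atTop ≤
        ENNReal.ofReal (2 * ((5 / 4 + h) / r)) := by
    intro r hr
    obtain ⟨g, hg⟩ := exists_tendsto_cauchyTransform h (z := ⟨0, r⟩) hr
    obtain ⟨i1, e1⟩ := sourceMap_of_tendsto h hr le_rfl hg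
    have h1 : (1 - ((⟨0, r⟩ : ℂ) * g)).re ≤ (5 / 4 + h) / r :=
      (Complex.re_le_norm _).trans (norm_one_sub_mul_le hh hr i1 e1)
    have h2 : Tendsto (fun n => ENNReal.ofReal
        (2 * (1 - ((⟨0, r⟩ : ℂ) * cauchyTransform (zeroMeasure h n) ⟨0, r⟩)).re)) atTop
        (𝓝 (ENNReal.ofReal (2 * (1 - ((⟨0, r⟩ : ℂ) * g)).re))) :=
      ENNReal.tendsto_ofReal (((Complex.continuous_re.tendsto _).comp
        (tendsto_const_nhds.sub (hg.const_mul _))).const_mul 2)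
    calc _ ≤ limsup (fun n => ENNReal.ofReal
          (2 * (1 - ((⟨0, r⟩ : ℂ) * cauchyTransform (zeroMeasure h n) ⟨0, r⟩)).re)) atTop := by
          refine limsup_le_limsup (Eventually.of_forall fun n => ?_)
          have := measureReal_tail_le (zeroMeasure h n) hr
          exact (ENNReal.le_ofReal_iff_toReal_le (measure_ne_top _ _)
            (measureReal_nonneg.trans this)).2 this
      _ = _ := h2.limsup_eq
      _ ≤ _ := ENNReal.ofReal_le_ofReal (by linarith)
  have hlim : Tendsto (fun r : ℝ => ENNReal.ofReal (2 * ((5 / 4 + h) / r))) atTop (𝓝 0) := by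
    have h1 : Tendsto (fun r : ℝ => 2 * ((5 / 4 + h) / r)) atTop (𝓝 0) := by
      simpa using (tendsto_const_nhds.div_atTop tendsto_id).const_mul (2 : ℝ)
    simpa using ENNReal.tendsto_ofReal h1
  refine tendsto_of_tendsto_of_tendsto_of_le_of_le' tendsto_const_nhds hlim
    (Eventually.of_forall fun _ => zero_le) ?_
  filter_upwards [eventually_gt_atTop 0] with r hr using hbound r hr

/-- The zero distributions converge weakly to a solution of the functional equation. -/
lemma exists_limit_measure {h : ℝ} (hh : 0 < h) :
    ∃ μ : ProbabilityMeasure ℝ, SolvesSourceEquation h μ ∧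
      ∀ f : ℝ →ᵇ ℝ, Tendsto (fun n => ∫ x, f x ∂(zeroMeasure h n)) atTop (𝓝 (∫ x, f x ∂μ)) := by
  set ν : ℕ → ProbabilityMeasure ℝ := fun n => ⟨zeroMeasure h n, inferInstance⟩ with hν
  have hcomp : IsCompact (closure (Set.range ν)) := by
    refine isCompact_closure_of_isTightMeasureSet ?_
    refine (isTightMeasureSet_zeroMeasure hh).subset ?_
    rintro _ ⟨_, ⟨n, rfl⟩, rfl⟩
    exact ⟨n, rfl⟩
  have hlim : ∀ U : Ultrafilter ℕ, (U : Filter ℕ) ≤ atTop →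
      ∃ μ : ProbabilityMeasure ℝ, SolvesSourceEquation h μ ∧ Tendsto ν U (𝓝 μ) := by
    intro U hU
    obtain ⟨μ, -, hμ⟩ := hcomp.ultrafilter_le_nhds (U.map ν) (by
      rw [Ultrafilter.coe_map, le_principal_iff, mem_map]
      exact Eventually.of_forall fun n => subset_closure ⟨n, rfl⟩)
    have hμ : Tendsto ν U (𝓝 μ) := hμ
    refine ⟨μ, fun z hz => ?_, hμ⟩
    have h1 := (ProbabilityMeasure.tendsto_iff_forall_integral_rclike_tendsto ℂ).1 hμ
      (cauchyKernel z hz)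
    exact (sourceMap_of_tendsto h hz hU h1).2
  obtain ⟨μ, hμ, -⟩ := hlim (Ultrafilter.of atTop) (Ultrafilter.of_le _)
  refine ⟨μ, hμ, ?_⟩
  have hconv : Tendsto ν atTop (𝓝 μ) := by
    refine (tendsto_iff_ultrafilter _ _ _).2 fun U hU => ?_
    obtain ⟨μ', hμ', ht⟩ := hlim U hU
    have := μ.2
    have := μ'.2
    have : μ' = μ := Subtype.ext (hμ'.unique hμ)
    rwa [this] at ht
  exact ProbabilityMeasure.tendsto_iff_forall_integral_tendsto.1 hconv

/-! ### Density and support of the limiting distribution -/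

/-- A measure whose small balls centred in an open set have mass at most a constant times their
radius is bounded there by a multiple of Lebesgue measure. -/
lemma restrict_le_smul_volume (μ : Measure ℝ) [IsFiniteMeasure μ] {J : Set ℝ} (hJ : IsOpen J)
    {C δ : ℝ} (hC : 0 < C) (hδ : 0 < δ)
    (hb : ∀ x ∈ J, ∀ y, 0 < y → y < δ → μ.real (Metric.closedBall x y) ≤ C * y) :
    μ.restrict J ≤ ENNReal.ofReal C • volume := by
  have hC0 : ENNReal.ofReal C ≠ 0 := by simpa using hC
  have key : (ENNReal.ofReal C)⁻¹ • μ.restrict J ≤ volume := by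
    rw [← hausdorffMeasure_real]
    refine Measure.le_hausdorffMeasure 1 _ (ENNReal.ofReal (δ / 2)) (by simpa using hδ)
      fun s hs => ?_
    rw [Measure.smul_apply, Measure.restrict_apply' hJ.measurableSet, ENNReal.rpow_one,
      smul_eq_mul, ENNReal.inv_mul_le_iff hC0 ENNReal.ofReal_ne_top]
    rcases (s ∩ J).eq_empty_or_nonempty with he | ⟨x, hxs, hxJ⟩
    · simp [he]
    have hfin : Metric.ediam s ≠ ⊤ := (hs.trans_lt ENNReal.ofReal_lt_top).ne
    have hd : Metric.ediam s = ENNReal.ofReal (Metric.diam s) :=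
      (ENNReal.ofReal_toReal hfin).symm
    have hdδ : Metric.diam s < δ := by
      have := ENNReal.toReal_mono ENNReal.ofReal_ne_top hs
      rw [ENNReal.toReal_ofReal (by linarith)] at this
      exact this.trans_lt (by linarith)
    rw [hd, ← ENNReal.ofReal_mul hC.le]
    have hcont : Continuous fun y : ℝ => ENNReal.ofReal (C * y) :=
      ENNReal.continuous_ofReal.comp (continuous_const.mul continuous_id)
    refine ge_of_tendsto ((hcont.tendsto (Metric.diam s)).mono_left
      (nhdsWithin_le_nhds (s := Set.Ioi (Metric.diam s)))) ?_
    filter_upwards [Ioo_mem_nhdsGT hdδ] with y hy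
    have hsub : s ∩ J ⊆ Metric.closedBall x y := fun t ht =>
      (Metric.dist_le_diam_of_mem (Metric.isBounded_iff_ediam_ne_top.2 hfin) ht.1 hxs).trans
        hy.1.le
    refine (measure_mono hsub).trans ?_
    have h1 := hb x hxJ y (Metric.diam_nonneg.trans_lt hy.1) hy.2
    exact (ENNReal.le_ofReal_iff_toReal_le (measure_ne_top _ _) (measureReal_nonneg.trans h1)).2 h1
  refine Measure.le_iff.2 fun s hs => ?_
  have := Measure.le_iff.1 key s hs
  rwa [Measure.smul_apply, smul_eq_mul, ENNReal.inv_mul_le_iff hC0 ENNReal.ofReal_ne_top] at this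

lemma im_subordination (g z : ℂ) : (z - 3 / 2 * g).im = z.im + 3 / 2 * -g.im := by
  have h1 : (3 / 2 : ℂ) = ((3 / 2 : ℝ) : ℂ) := by push_cast; ring
  rw [Complex.sub_im, h1, Complex.im_ofReal_mul]
  ring

lemma SolvesSourceEquation.sourceSum_lt_one {h : ℝ} {μ : Measure ℝ} [IsFiniteMeasure μ]
    (hμ : SolvesSourceEquation h μ) {z : ℂ} (hz : 0 < z.im) :
    sourceSum h (z - 3 / 2 * cauchyTransform μ z) < 1 :=
  _root_.sourceSum_lt_one (hz.trans_le (im_le_im_subordination μ hz)) (by rwa [hμ z hz])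

lemma SolvesSourceEquation.norm_sub_le {h : ℝ} {μ : Measure ℝ} [IsFiniteMeasure μ]
    (hμ : SolvesSourceEquation h μ) {z : ℂ} (hz : 0 < z.im) :
    ‖z - (z - 3 / 2 * cauchyTransform μ z)‖ ≤ 5 / 4 := by
  have h1 := norm_sub_sourceMap_le h (z - 3 / 2 * cauchyTransform μ z)
  rw [hμ z hz] at h1
  linarith [hμ.sourceSum_lt_one hz]

lemma SolvesSourceEquation.absolutelyContinuous {h : ℝ} {μ : Measure ℝ} [IsFiniteMeasure μ]
    (hμ : SolvesSourceEquation h μ) : μ ≪ volume := by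
  have h1 : μ.restrict Set.univ ≤ ENNReal.ofReal 2 • volume := by
    refine restrict_le_smul_volume μ isOpen_univ two_pos one_pos fun x _ y hy _ => ?_
    refine (measureReal_closedBall_le μ x hy).trans ?_
    have h2 := hμ.norm_sub_le (z := ⟨x, y⟩) hy
    have h3 := (Complex.abs_im_le_norm _).trans h2
    rw [Complex.sub_im, im_subordination] at h3
    have h4 := (abs_le.1 h3).1
    nlinarith
  rw [Measure.restrict_univ] at h1
  exact (Measure.absolutelyContinuous_of_le h1).trans (Measure.smul_absolutelyContinuous)

/-- The restriction of `ψ` to the real line. -/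
noncomputable def realMap (h u : ℝ) : ℝ := u + 1 / 2 * (1 / (u + h) + 1 / u + 1 / (u - h))

/-- The restriction of `sourceSum` to the real line. -/
noncomputable def realSum (h u : ℝ) : ℝ :=
  1 / 2 * (1 / (u + h) ^ 2 + 1 / u ^ 2 + 1 / (u - h) ^ 2)

/-- The real points, other than the poles, at which `ψ' > 0`. -/
def gapSet (h : ℝ) : Set ℝ := {u | (u + h ≠ 0 ∧ u ≠ 0 ∧ u - h ≠ 0) ∧ realSum h u < 1}

lemma sourceMap_ofReal (h u : ℝ) : sourceMap h u = (realMap h u : ℝ) := by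
  rw [sourceMap, realMap]; push_cast; ring

lemma sourceSum_ofReal (h u : ℝ) : sourceSum h u = realSum h u := by
  rw [sourceSum, realSum, ← Complex.ofReal_add, ← Complex.ofReal_sub, Complex.normSq_ofReal,
    Complex.normSq_ofReal, Complex.normSq_ofReal, sq, sq, sq]

lemma offPoles_ofReal {h u : ℝ} : OffPoles h u ↔ u + h ≠ 0 ∧ u ≠ 0 ∧ u - h ≠ 0 := by
  rw [OffPoles]
  norm_cast

/-- `ψ` is strictly increasing on the set where `ψ' ≥ 0`, although this set is not connected. -/
lemma realMap_lt_realMap {h u v : ℝ} (hu : u + h ≠ 0 ∧ u ≠ 0 ∧ u - h ≠ 0)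
    (hv : v + h ≠ 0 ∧ v ≠ 0 ∧ v - h ≠ 0) (su : realSum h u ≤ 1) (sv : realSum h v ≤ 1)
    (huv : u < v) : realMap h u < realMap h v := by
  obtain ⟨a1, a2, a3⟩ := hu
  obtain ⟨b1, b2, b3⟩ := hv
  have hsub : realMap h v - realMap h u = (v - u) *
      (1 - 1 / 2 * (1 / (v + h) * (1 / (u + h)) + 1 / v * (1 / u) + 1 / (v - h) * (1 / (u - h)))) := by
    rw [realMap, realMap]; field_simp; ring
  have hne : 1 / v - 1 / u ≠ 0 := by
    rw [div_sub_div _ _ b2 a2]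
    refine div_ne_zero (by linarith) (mul_ne_zero b2 a2)
  have hpos : 0 < 1 - 1 / 2 *
      (1 / (v + h) * (1 / (u + h)) + 1 / v * (1 / u) + 1 / (v - h) * (1 / (u - h))) := by
    simp only [realSum, ← one_div_pow] at su sv
    nlinarith [sq_nonneg (1 / (v + h) - 1 / (u + h)), sq_pos_of_ne_zero hne,
      sq_nonneg (1 / (v - h) - 1 / (u - h))]
  have := mul_pos (sub_pos.2 huv) hpos
  linarith

lemma isOpen_offPoles (h : ℝ) : IsOpen {u : ℝ | u + h ≠ 0 ∧ u ≠ 0 ∧ u - h ≠ 0} := by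
  refine IsOpen.and ?_ (IsOpen.and ?_ ?_)
  · exact isOpen_ne_fun (by fun_prop) (by fun_prop)
  · exact isOpen_ne_fun (by fun_prop) (by fun_prop)
  · exact isOpen_ne_fun (by fun_prop) (by fun_prop)

lemma continuousAt_realMap {h u : ℝ} (hu : u + h ≠ 0 ∧ u ≠ 0 ∧ u - h ≠ 0) :
    ContinuousAt (realMap h) u := by
  obtain ⟨a1, a2, a3⟩ := hu
  unfold realMap
  fun_prop (disch := assumption)

lemma continuousAt_realSum {h u : ℝ} (hu : u + h ≠ 0 ∧ u ≠ 0 ∧ u - h ≠ 0) :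
    ContinuousAt (realSum h) u := by
  obtain ⟨a1, a2, a3⟩ := hu
  have := pow_ne_zero 2 a1; have := pow_ne_zero 2 a2; have := pow_ne_zero 2 a3
  unfold realSum
  fun_prop (disch := assumption)

/-- The image under `ψ` of a real point with `ψ' > 0` is outside the support: there the
subordination function extends continuously to the real line, with real values. -/
lemma SolvesSourceEquation.realMap_notMem_support {h : ℝ} {μ : Measure ℝ} [IsFiniteMeasure μ]
    (hμ : SolvesSourceEquation h μ) {u₀ : ℝ} (hu₀ : u₀ ∈ gapSet h) :
    realMap h u₀ ∉ μ.support := by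
  obtain ⟨hoff, hs⟩ := hu₀
  obtain ⟨ρ, hρ0, hρ1⟩ := exists_between hs
  have hev : ∀ᶠ u in 𝓝 u₀, (u + h ≠ 0 ∧ u ≠ 0 ∧ u - h ≠ 0) ∧ realSum h u < ρ :=
    Eventually.and ((isOpen_offPoles h).mem_nhds hoff)
      ((continuousAt_realSum hoff).eventually (gt_mem_nhds hρ0))
  obtain ⟨ε, hε, hball⟩ := Metric.eventually_nhds_iff_ball.1 hev
  set η := ε / 2 with hη
  have hηpos : 0 < η := by positivity
  have hI : ∀ u ∈ Set.Icc (u₀ - η) (u₀ + η), (u + h ≠ 0 ∧ u ≠ 0 ∧ u - h ≠ 0) ∧ realSum h u < ρ := by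
    intro u hu
    refine hball u ?_
    rw [Metric.mem_ball, Real.dist_eq, abs_lt]
    constructor <;> linarith [hu.1, hu.2]
  have hl := hI (u₀ - η) ⟨le_rfl, by linarith⟩
  have hr := hI (u₀ + η) ⟨by linarith, le_rfl⟩
  set J := Set.Ioo (realMap h (u₀ - η)) (realMap h (u₀ + η)) with hJ
  have hJmem : realMap h u₀ ∈ J :=
    ⟨realMap_lt_realMap hl.1 hoff (hl.2.trans hρ1).le hs.le (by linarith),
      realMap_lt_realMap hoff hr.1 hs.le (hr.2.trans hρ1).le (by linarith)⟩
  have hκ : 0 < (1 - ρ) / 2 := by linarith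
  have hbound : ∀ x ∈ J, ∀ y, 0 < y → -(cauchyTransform μ ⟨x, y⟩).im ≤ y / ((1 - ρ) / 2) := by
    intro x hx y hy
    obtain ⟨u, huI, hux⟩ : x ∈ realMap h '' Set.Icc (u₀ - η) (u₀ + η) :=
      intermediate_value_Icc (by linarith)
        (fun u hu => (continuousAt_realMap (hI u hu).1).continuousWithinAt) ⟨hx.1.le, hx.2.le⟩
    have hz : (0 : ℝ) < (⟨x, y⟩ : ℂ).im := hy
    set w := (⟨x, y⟩ : ℂ) - 3 / 2 * cauchyTransform μ ⟨x, y⟩ with hw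
    have hwim : (⟨x, y⟩ : ℂ).im ≤ w.im := im_le_im_subordination μ hz
    have h1 := norm_sub_mul_le_norm_sourceMap_sub (h := h) (w₁ := w) (w₂ := u)
      (offPoles_of_im_pos h (hz.trans_le hwim)) (offPoles_ofReal.2 (hI u huI).1)
    have h2 : sourceMap h w - sourceMap h u = ⟨0, y⟩ := by
      rw [hμ _ hz, sourceMap_ofReal, hux]
      apply Complex.ext <;> simp
    have h3 : ‖(⟨0, y⟩ : ℂ)‖ ≤ y := by
      have := Complex.norm_le_abs_re_add_abs_im ⟨0, y⟩
      simpa [abs_of_pos hy] using this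
    rw [h2, sourceSum_ofReal] at h1
    have h4 := hμ.sourceSum_lt_one hz
    rw [← hw] at h4
    have h5 : ‖w - u‖ * ((1 - ρ) / 2) ≤ y := by
      refine le_trans (mul_le_mul_of_nonneg_left ?_ (norm_nonneg _)) (h1.trans h3)
      linarith [(hI u huI).2]
    have h6 : w.im ≤ ‖w - u‖ := im_le_norm_sub_ofReal w u
    have h7 : w.im = y + 3 / 2 * -(cauchyTransform μ ⟨x, y⟩).im := im_subordination _ _
    rw [le_div_iff₀ hκ]
    have h8 := im_cauchyTransform_nonpos μ hz
    have h9 : -(cauchyTransform μ ⟨x, y⟩).im ≤ ‖w - u‖ := by linarith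
    exact (mul_le_mul_of_nonneg_right h9 hκ.le).trans h5
  have hzero : μ J = 0 := by
    have hle : ∀ C : ℝ, 0 < C → μ J ≤ ENNReal.ofReal C * volume J := by
      intro C hC
      have h1 := restrict_le_smul_volume μ (J := J) isOpen_Ioo hC (δ := C * ((1 - ρ) / 2) / 2)
        (by positivity) fun x hx y hy hyδ => by
          refine (measureReal_closedBall_le μ x hy).trans ?_
          have h2 := hbound x hx y hy
          have h3 : y / ((1 - ρ) / 2) ≤ C / 2 := by
            rw [div_le_iff₀ hκ]; linarith
          nlinarith
      have h4 := h1 J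
      rwa [Measure.restrict_apply_self, Measure.smul_apply, smul_eq_mul] at h4
    have hvol : volume J ≠ ⊤ := by rw [hJ, Real.volume_Ioo]; exact ENNReal.ofReal_ne_top
    have hlim : Tendsto (fun C : ℝ => ENNReal.ofReal C * volume J) (𝓝[>] 0) (𝓝 0) := by
      have h1 : Tendsto (fun C : ℝ => ENNReal.ofReal C) (𝓝[>] 0) (𝓝 0) := by
        have := (ENNReal.continuous_ofReal.tendsto 0).mono_left
          (nhdsWithin_le_nhds (s := Set.Ioi (0 : ℝ)))
        simpa using this
      simpa using ENNReal.Tendsto.mul_const h1 (Or.inr hvol)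
    refine le_antisymm (ge_of_tendsto hlim ?_) bot_le
    filter_upwards [self_mem_nhdsWithin] with C hC using hle C hC
  exact Measure.notMem_support_iff_exists.2 ⟨J, isOpen_Ioo.mem_nhds hJmem, hzero⟩

lemma half_le_normSq {h : ℝ} {w : ℂ} (hw : OffPoles h w) (hs : sourceSum h w ≤ 1) :
    1 / 2 ≤ Complex.normSq (w + h) ∧ 1 / 2 ≤ Complex.normSq w ∧
      1 / 2 ≤ Complex.normSq (w - h) := by
  have h1 := fun t : ℂ => one_div_nonneg.2 (Complex.normSq_nonneg t)
  have e1 := h1 (w + h)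
  have e2 := h1 w
  have e3 := h1 (w - h)
  rw [sourceSum] at hs
  have h2 : ∀ t : ℂ, t ≠ 0 → 1 / Complex.normSq t ≤ 2 → 1 / 2 ≤ Complex.normSq t := by
    intro t ht hle
    rw [div_le_iff₀ (Complex.normSq_pos.2 ht)] at hle
    linarith
  exact ⟨h2 _ hw.1 (by linarith), h2 _ hw.2.1 (by linarith), h2 _ hw.2.2 (by linarith)⟩

/-- A point outside the support is the image under `ψ` of a real point with `ψ' > 0`, namely of the
boundary value of the subordination function. -/
lemma SolvesSourceEquation.mem_image_of_notMem_support {h : ℝ} {μ : Measure ℝ}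
    [IsProbabilityMeasure μ] (hμ : SolvesSourceEquation h μ) {x : ℝ} (hx : x ∉ μ.support) :
    x ∈ realMap h '' gapSet h := by
  obtain ⟨N, hN, hN0⟩ := Measure.notMem_support_iff_exists.1 hx
  obtain ⟨r, hr, hrN⟩ := Metric.mem_nhds_iff.1 hN
  have hae : ∀ᵐ t ∂μ, r ≤ |x - t| := by
    have : ∀ᵐ t ∂μ, t ∉ Metric.ball x r := measure_eq_zero_iff_ae_notMem.1
      (measure_mono_null hrN hN0)
    filter_upwards [this] with t ht
    rwa [Metric.mem_ball, Real.dist_eq, not_lt, abs_sub_comm] at ht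
  set w : ℝ → ℂ := fun y => ⟨x, y⟩ - 3 / 2 * cauchyTransform μ ⟨x, y⟩ with hw
  set M : ℝ := 1 + 3 / 2 * (1 / r ^ 2) with hM
  have hMpos : 0 < M := by positivity
  have hmap : ∀ y, 0 < y → sourceMap h (w y) = ⟨x, y⟩ := fun y hy => hμ ⟨x, y⟩ hy
  have hpos : ∀ y, 0 < y → 0 < (w y).im := fun y hy =>
    lt_of_lt_of_le (show (0 : ℝ) < (⟨x, y⟩ : ℂ).im from hy) (im_le_im_subordination μ hy)
  have him : ∀ y, 0 < y → (w y).im ≤ y * M := by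
    intro y hy
    have h1 : -(cauchyTransform μ ⟨x, y⟩).im ≤ y * (1 / r ^ 2) := by
      obtain ⟨i1, i2⟩ := im_cauchyTransform μ (z := ⟨x, y⟩) hy
      rw [i2, neg_neg]
      have : ∫ t : ℝ, y / Complex.normSq (⟨x, y⟩ - (t : ℂ)) ∂μ ≤
          ∫ _ : ℝ, y * (1 / r ^ 2) ∂μ := by
        refine integral_mono_ae i1 (integrable_const _) ?_
        filter_upwards [hae] with t ht
        rw [normSq_mk_sub, div_eq_mul_one_div]
        have : r ^ 2 ≤ (x - t) ^ 2 := by rw [← sq_abs (x - t)]; gcongr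
        gcongr
        nlinarith
      simpa using this
    have h2 : (w y).im = y + 3 / 2 * -(cauchyTransform μ ⟨x, y⟩).im := im_subordination _ _
    rw [h2, hM]
    linarith
  have hS : ∀ y, 0 < y → sourceSum h (w y) ≤ 1 - 1 / M := by
    intro y hy
    have h1 := sourceMap_im h (w y)
    rw [hmap y hy] at h1
    change y = _ at h1
    have h2 := hμ.sourceSum_lt_one (z := ⟨x, y⟩) hy
    have h3 : y ≤ y * M * (1 - sourceSum h (w y)) := by
      conv_lhs => rw [h1]
      exact mul_le_mul_of_nonneg_right (him y hy) (by linarith)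
    have h4 : 1 ≤ M * (1 - sourceSum h (w y)) := by
      by_contra! hlt
      nlinarith
    have h5 : 1 / M ≤ 1 - sourceSum h (w y) := by rw [div_le_iff₀ hMpos]; linarith
    linarith
  have hbd : ∀ y, 0 < y → y < 1 → w y ∈ Metric.closedBall (x : ℂ) (5 / 4 + 1) := by
    intro y hy hy1
    have h1 : ‖(⟨x, y⟩ : ℂ) - w y‖ ≤ 5 / 4 := hμ.norm_sub_le hy
    have h2 : ‖(⟨x, y⟩ : ℂ) - x‖ ≤ 1 := by
      have e : (⟨x, y⟩ : ℂ) - x = ⟨0, y⟩ := by apply Complex.ext <;> simp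
      have := Complex.norm_le_abs_re_add_abs_im ⟨0, y⟩
      rw [e]
      simp only [abs_zero, zero_add, abs_of_pos hy] at this
      linarith
    rw [Metric.mem_closedBall, dist_eq_norm]
    have e : w y - x = -((⟨x, y⟩ : ℂ) - w y) + ((⟨x, y⟩ : ℂ) - x) := by ring
    rw [e]
    refine (norm_add_le _ _).trans ?_
    rw [norm_neg]
    linarith
  set U := Ultrafilter.of (𝓝[>] (0 : ℝ)) with hU
  have hU0 : (U : Filter ℝ) ≤ 𝓝[>] 0 := Ultrafilter.of_le _
  have hUpos : ∀ᶠ y in (U : Filter ℝ), 0 < y := hU0 self_mem_nhdsWithin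
  have hUone : ∀ᶠ y in (U : Filter ℝ), y < 1 :=
    hU0 (nhdsWithin_le_nhds (gt_mem_nhds one_pos))
  have hUid : Tendsto (fun y : ℝ => y) U (𝓝 0) := hU0.trans nhdsWithin_le_nhds
  obtain ⟨u, -, hu⟩ := (isCompact_closedBall (x : ℂ) (5 / 4 + 1)).ultrafilter_le_nhds (U.map w) (by
    rw [Ultrafilter.coe_map, le_principal_iff, mem_map]
    filter_upwards [hUpos, hUone] with y h0 h1 using hbd y h0 h1)
  have hu : Tendsto w U (𝓝 u) := hu
  have hnormSq : ∀ a : ℂ, (∀ᶠ y in (U : Filter ℝ), 1 / 2 ≤ Complex.normSq (w y + a)) →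
      u + a ≠ 0 := by
    intro a ha h0
    have h1 : Tendsto (fun y => Complex.normSq (w y + a)) U (𝓝 (Complex.normSq (u + a))) :=
      (Complex.continuous_normSq.tendsto _).comp (hu.add_const a)
    have h2 := ge_of_tendsto h1 ha
    rw [h0, map_zero] at h2
    linarith
  have hhalf : ∀ᶠ y in (U : Filter ℝ), 1 / 2 ≤ Complex.normSq (w y + h) ∧
      1 / 2 ≤ Complex.normSq (w y) ∧ 1 / 2 ≤ Complex.normSq (w y - h) := by
    filter_upwards [hUpos] with y hy
    exact half_le_normSq (offPoles_of_im_pos h (hpos y hy))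
      ((hS y hy).trans (by have := one_div_pos.2 hMpos; linarith))
  have hoff : OffPoles h u := by
    refine ⟨hnormSq h (hhalf.mono fun y hy => hy.1), ?_, ?_⟩
    · have := hnormSq 0 (hhalf.mono fun y hy => by simpa using hy.2.1)
      simpa using this
    · have := hnormSq (-h) (hhalf.mono fun y hy => by
        rw [← sub_eq_add_neg]; exact hy.2.2)
      rwa [← sub_eq_add_neg] at this
  have huim : u.im = 0 := by
    have h1 : Tendsto (fun y => (w y).im) U (𝓝 u.im) := (Complex.continuous_im.tendsto _).comp hu
    refine tendsto_nhds_unique h1 ?_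
    have h2 : Tendsto (fun y : ℝ => y * M) U (𝓝 0) := by simpa using hUid.mul_const M
    refine tendsto_of_tendsto_of_tendsto_of_le_of_le' tendsto_const_nhds h2 ?_ ?_
    · filter_upwards [hUpos] with y hy using (hpos y hy).le
    · filter_upwards [hUpos] with y hy using him y hy
  have hureal : u = (u.re : ℂ) := Complex.ext (by simp) (by simp [huim])
  have hψ : sourceMap h u = x := by
    obtain ⟨a1, a2, a3⟩ := hoff
    have hc : ContinuousAt (sourceMap h) u := by
      unfold sourceMap
      fun_prop (disch := assumption)
    have h1 : Tendsto (fun y => sourceMap h (w y)) U (𝓝 (sourceMap h u)) := hc.tendsto.comp hu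
    refine tendsto_nhds_unique h1 ?_
    have h2 : Tendsto (fun y : ℝ => (x : ℂ) + y * Complex.I) U (𝓝 (x + (0 : ℝ) * Complex.I)) :=
      tendsto_const_nhds.add (((Complex.continuous_ofReal.tendsto 0).comp hUid).mul_const _)
    simp only [Complex.ofReal_zero, zero_mul, add_zero] at h2
    refine h2.congr' ?_
    filter_upwards [hUpos] with y hy
    rw [hmap y hy]
    apply Complex.ext <;> simp
  have hsum : sourceSum h u ≤ 1 - 1 / M := by
    obtain ⟨a1, a2, a3⟩ := hoff
    have hc : ContinuousAt (sourceSum h) u := by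
      have b1 := (Complex.normSq_pos.2 a1).ne'
      have b2 := (Complex.normSq_pos.2 a2).ne'
      have b3 := (Complex.normSq_pos.2 a3).ne'
      have hn := Complex.continuous_normSq
      unfold sourceSum
      fun_prop (disch := assumption)
    refine le_of_tendsto (hc.tendsto.comp hu) ?_
    filter_upwards [hUpos] with y hy using hS y hy
  rw [hureal] at hψ hsum hoff
  rw [sourceSum_ofReal] at hsum
  rw [sourceMap_ofReal] at hψ
  exact ⟨u.re, ⟨offPoles_ofReal.1 hoff, hsum.trans_lt (by have := one_div_pos.2 hMpos; linarith)⟩,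
    by exact_mod_cast hψ⟩

/-- The complement of the support of the limiting distribution is the image under `ψ` of the set
of real points at which `ψ' > 0`. -/
lemma SolvesSourceEquation.support_eq {h : ℝ} {μ : Measure ℝ} [IsProbabilityMeasure μ]
    (hμ : SolvesSourceEquation h μ) : μ.support = (realMap h '' gapSet h)ᶜ := by
  ext x
  rw [Set.mem_compl_iff]
  constructor
  · rintro hx ⟨u, hu, rfl⟩
    exact hμ.realMap_notMem_support hu hx
  · intro hx
    by_contra hx'
    exact hx (hμ.mem_image_of_notMem_support hx')

/-! ### The real points where `ψ' > 0` -/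

/-- The cubic whose sign at `u²`, for `k = h²`, is the sign of `ψ'(u)` away from the poles of
`ψ`. -/
def gapCubic (k s : ℝ) : ℝ := 2 * s * (s - k) ^ 2 - 3 * s ^ 2 - k ^ 2

lemma one_sub_realSum {h u : ℝ} (hu : u + h ≠ 0 ∧ u ≠ 0 ∧ u - h ≠ 0) :
    1 - realSum h u = gapCubic (h ^ 2) (u ^ 2) / (2 * (u * (u + h) * (u - h)) ^ 2) := by
  obtain ⟨a1, a2, a3⟩ := hu
  rw [realSum, gapCubic]
  field_simp
  ring

/-- At the poles the cubic is negative, so its nonnegativity rules them out. -/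
lemma offPoles_of_gapCubic_nonneg {h u : ℝ} (hh : 0 < h) (hF : 0 ≤ gapCubic (h ^ 2) (u ^ 2)) :
    u + h ≠ 0 ∧ u ≠ 0 ∧ u - h ≠ 0 := by
  have hpos : 0 < h ^ 4 := by positivity
  refine ⟨fun h0 => ?_, fun h0 => ?_, fun h0 => ?_⟩
  · have : u = -h := by linarith
    rw [this, gapCubic] at hF; nlinarith
  · rw [h0, gapCubic] at hF; nlinarith
  · have : u = h := by linarith
    rw [this, gapCubic] at hF; nlinarith

lemma realSum_le_one {h u : ℝ} (hh : 0 < h) (hF : 0 ≤ gapCubic (h ^ 2) (u ^ 2)) :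
    realSum h u ≤ 1 := by
  have := one_sub_realSum (offPoles_of_gapCubic_nonneg hh hF)
  have h2 : 0 ≤ gapCubic (h ^ 2) (u ^ 2) / (2 * (u * (u + h) * (u - h)) ^ 2) := by positivity
  linarith

lemma mem_gapSet_iff {h u : ℝ} (hh : 0 < h) : u ∈ gapSet h ↔ 0 < gapCubic (h ^ 2) (u ^ 2) := by
  constructor
  · rintro ⟨hoff, hs⟩
    have h1 := one_sub_realSum hoff
    obtain ⟨a1, a2, a3⟩ := hoff
    have h2 : 0 < 2 * (u * (u + h) * (u - h)) ^ 2 := by positivity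
    have h3 : 0 < gapCubic (h ^ 2) (u ^ 2) / (2 * (u * (u + h) * (u - h)) ^ 2) := by linarith
    exact (div_pos_iff_of_pos_right h2).1 h3
  · intro hF
    have hoff := offPoles_of_gapCubic_nonneg hh hF.le
    have h1 := one_sub_realSum hoff
    refine ⟨hoff, ?_⟩
    obtain ⟨a1, a2, a3⟩ := hoff
    have h3 : 0 < gapCubic (h ^ 2) (u ^ 2) / (2 * (u * (u + h) * (u - h)) ^ 2) := by positivity
    linarith

lemma continuous_gapCubic (k : ℝ) : Continuous (gapCubic k) := by
  unfold gapCubic; fun_prop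

lemma gapCubic_pos_of_lt {k s t : ℝ} (hk : 0 < k) (hs : k < s) (hst : s < t)
    (hF : 0 ≤ gapCubic k s) : 0 < gapCubic k t := by
  rw [gapCubic] at hF ⊢
  have hspos : 0 < s := hk.trans hs
  have htpos : 0 < t := hspos.trans hst
  -- `(s - k)² / s` is increasing for `s > k`
  have h1 : (s - k) ^ 2 * t < (t - k) ^ 2 * s := by
    have h2 : (t - k) ^ 2 * s - (s - k) ^ 2 * t = (t - s) * (t * s - k ^ 2) := by ring
    have h3 : 0 < t * s - k ^ 2 := by nlinarith
    nlinarith [mul_pos (sub_pos.2 hst) h3]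
  have h4 : 0 < (2 * t * (t - k) ^ 2 - 3 * t ^ 2 - k ^ 2) * s ^ 2 := by
    have h5 := mul_lt_mul_of_pos_left h1 (by positivity : 0 < 2 * t * s)
    have h6 := mul_nonneg hF (sq_nonneg t)
    have h7 : 0 < k ^ 2 * (t ^ 2 - s ^ 2) := mul_pos (by positivity) (by nlinarith)
    nlinarith
  exact (pos_iff_pos_of_mul_pos h4).2 (by positivity)

/-- The cubic has exactly one root beyond `k`, where it changes sign. -/
lemma exists_largest_root {k : ℝ} (hk : 0 < k) :
    ∃ r, k < r ∧ gapCubic k r = 0 ∧ ∀ s, k < s → (0 < gapCubic k s ↔ r < s) := by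
  have h1 : gapCubic k k < 0 := by
    rw [gapCubic]; nlinarith [pow_pos hk 2]
  have h2 : 0 < gapCubic k (4 * k + 4) := by
    rw [gapCubic]
    have : 2 * (4 * k + 4) * (4 * k + 4 - k) ^ 2 - 3 * (4 * k + 4) ^ 2 - k ^ 2 =
      72 * k ^ 3 + 215 * k ^ 2 + 224 * k + 80 := by ring
    rw [this]; positivity
  obtain ⟨r, hr, hr0⟩ := intermediate_value_Ioo (by linarith : k ≤ 4 * k + 4)
    (continuous_gapCubic k).continuousOn ⟨h1, h2⟩
  refine ⟨r, hr.1, hr0, fun s hs => ⟨fun hF => ?_, fun hrs => gapCubic_pos_of_lt hk hr.1 hrs hr0.ge⟩⟩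
  by_contra! hle
  rcases hle.lt_or_eq with hlt | heq
  · exact (gapCubic_pos_of_lt hk hs hlt hF.le).ne' hr0
  · rw [heq, hr0] at hF; exact lt_irrefl _ hF

lemma gapCubic_neg_of_nonpos {k s : ℝ} (hk : 0 < k) (hs : s ≤ 0) : gapCubic k s < 0 := by
  rw [gapCubic]
  nlinarith [mul_nonneg (neg_nonneg.2 hs) (sq_nonneg (s - k)), sq_nonneg s, pow_pos hk 2]

/-- If the cubic is positive somewhere in `(0, k)`, then it has three roots. -/
lemma exists_three_roots {k s₀ : ℝ} (hs₀ : 0 < s₀) (hs₀k : s₀ < k)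
    (hF : 0 < gapCubic k s₀) :
    ∃ r₁ r₂ r₃, 0 < r₁ ∧ r₁ < r₂ ∧ r₂ < k ∧ k < r₃ ∧
      ∀ s, gapCubic k s = 2 * (s - r₁) * (s - r₂) * (s - r₃) := by
  have hk : 0 < k := hs₀.trans hs₀k
  obtain ⟨r₁, h1, e1⟩ := intermediate_value_Ioo hs₀.le (continuous_gapCubic k).continuousOn
    ⟨gapCubic_neg_of_nonpos hk le_rfl, hF⟩
  have hkk : gapCubic k k < 0 := by rw [gapCubic]; nlinarith [pow_pos hk 2]
  obtain ⟨r₂, h2, e2⟩ := intermediate_value_Ioo' hs₀k.le (continuous_gapCubic k).continuousOn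
    ⟨hkk, hF⟩
  obtain ⟨r₃, h3, e3, -⟩ := exists_largest_root hk
  refine ⟨r₁, r₂, r₃, h1.1, h1.2.trans h2.1, h2.2, h3, fun s => ?_⟩
  have n12 : r₁ - r₂ ≠ 0 := by linarith [h1.2, h2.1]
  have n13 : r₁ - r₃ ≠ 0 := by linarith [h1.2, hs₀k]
  have n23 : r₂ - r₃ ≠ 0 := by linarith [h2.2]
  simp only [gapCubic] at e1 e2 e3 ⊢
  -- Vieta's formulas, from divided differences
  have d12 : 2 * (r₁ ^ 2 + r₁ * r₂ + r₂ ^ 2) - (4 * k + 3) * (r₁ + r₂) + 2 * k ^ 2 = 0 :=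
    mul_left_cancel₀ n12 (by linear_combination e1 - e2)
  have d13 : 2 * (r₁ ^ 2 + r₁ * r₃ + r₃ ^ 2) - (4 * k + 3) * (r₁ + r₃) + 2 * k ^ 2 = 0 :=
    mul_left_cancel₀ n13 (by linear_combination e1 - e3)
  have d123 : 2 * (r₁ + r₂ + r₃) - (4 * k + 3) = 0 :=
    mul_left_cancel₀ n23 (by linear_combination d12 - d13)
  linear_combination (s - r₁) * (s - r₂) * d123 + (s - r₁) * d12 + e1

/-! ### The image of the gaps -/

lemma realMap_neg (h u : ℝ) : realMap h (-u) = -realMap h u := by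
  rw [realMap, realMap, show -u + h = -(u - h) by ring, show -u - h = -(u + h) by ring]
  simp only [div_neg]
  ring

lemma neg_mem_gapSet {h u : ℝ} (hh : 0 < h) (hu : u ∈ gapSet h) : -u ∈ gapSet h := by
  rw [mem_gapSet_iff hh] at hu ⊢; rwa [neg_sq]

lemma realMap_strictMono {h u v : ℝ} (hh : 0 < h) (hu : 0 ≤ gapCubic (h ^ 2) (u ^ 2))
    (hv : 0 ≤ gapCubic (h ^ 2) (v ^ 2)) (huv : u < v) : realMap h u < realMap h v :=
  realMap_lt_realMap (offPoles_of_gapCubic_nonneg hh hu) (offPoles_of_gapCubic_nonneg hh hv)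
    (realSum_le_one hh hu) (realSum_le_one hh hv) huv

lemma lt_realMap {h u : ℝ} (hh : 0 < h) (hu : h < u) : u < realMap h u := by
  have h1 : 0 < 1 / (u + h) := by apply one_div_pos.2; linarith
  have h2 : 0 < 1 / u := by apply one_div_pos.2; linarith
  have h3 : 0 < 1 / (u - h) := by apply one_div_pos.2; linarith
  rw [realMap]; linarith

/-- By continuity, `ψ` maps an interval on which `ψ' > 0` onto a gap of the support. -/
lemma Ioo_subset_image_gapSet {h u v : ℝ} (hh : 0 < h) (huv : u ≤ v)
    (hgap : ∀ t ∈ Set.Icc u v, 0 ≤ gapCubic (h ^ 2) (t ^ 2))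
    (hgap' : ∀ t ∈ Set.Ioo u v, t ∈ gapSet h) :
    Set.Ioo (realMap h u) (realMap h v) ⊆ realMap h '' gapSet h := by
  intro y hy
  obtain ⟨t, ht, rfl⟩ := intermediate_value_Ioo huv (fun t ht =>
    (continuousAt_realMap (offPoles_of_gapCubic_nonneg hh (hgap t ht))).continuousWithinAt) hy
  exact ⟨t, hgap' t ht, rfl⟩

/-- The unbounded interval on which `ψ' > 0` is mapped onto an unbounded gap. -/
lemma Ioi_subset_image_gapSet {h B : ℝ} (hh : 0 < h) (hB : h < B)
    (hgap : 0 ≤ gapCubic (h ^ 2) (B ^ 2)) (hgap' : ∀ t, B < t → t ∈ gapSet h) :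
    Set.Ioi (realMap h B) ⊆ realMap h '' gapSet h := by
  intro y hy
  have h1 : y < max (y + 1) (B + 1) := (lt_add_one y).trans_le (le_max_left _ _)
  have h2 : B < max (y + 1) (B + 1) := (lt_add_one B).trans_le (le_max_right _ _)
  refine Ioo_subset_image_gapSet (u := B) (v := max (y + 1) (B + 1)) hh h2.le
    (fun t ht => ?_) (fun t ht => hgap' t ht.1) ⟨hy, h1.trans (lt_realMap hh (hB.trans h2))⟩
  rcases ht.1.eq_or_lt with rfl | hlt
  · exact hgap
  · exact ((mem_gapSet_iff hh).1 (hgap' t hlt)).le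

lemma mem_image_neg {h y : ℝ} (hh : 0 < h) (hy : -y ∈ realMap h '' gapSet h) :
    y ∈ realMap h '' gapSet h := by
  obtain ⟨u, hu, e⟩ := hy
  exact ⟨-u, neg_mem_gapSet hh hu, by rw [realMap_neg, e, neg_neg]⟩

/-- One interval: the cubic has no positive value in `(0, h²)`. -/
lemma compl_image_gapSet_of_one_cut {h : ℝ} (hh : 0 < h)
    (hF : ∀ s, 0 < s → s < h ^ 2 → gapCubic (h ^ 2) s ≤ 0) :
    ∃ b : ℝ, 0 < b ∧ (realMap h '' gapSet h)ᶜ = Set.Icc (-b) b := by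
  have hk : 0 < h ^ 2 := by positivity
  obtain ⟨r, hr, hr0, hiff⟩ := exists_largest_root hk
  have hBsq : √r ^ 2 = r := Real.sq_sqrt (hk.trans hr).le
  have hB : h < √r := Real.lt_sqrt_of_sq_lt hr
  have hB0 : 0 ≤ gapCubic (h ^ 2) (√r ^ 2) := by rw [hBsq, hr0]
  have hmem : ∀ t, 0 < t → (t ∈ gapSet h ↔ √r < t) := by
    intro t ht
    rw [mem_gapSet_iff hh]
    have h1 : √r < t ↔ r < t ^ 2 := Real.sqrt_lt' ht
    rw [h1]
    constructor
    · intro hpos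
      rcases lt_or_ge (h ^ 2) (t ^ 2) with hlt | hge
      · exact (hiff _ hlt).1 hpos
      · exfalso
        rcases hge.lt_or_eq with hlt | heq
        · exact absurd (hF _ (by positivity) hlt) (not_le.2 hpos)
        · rw [heq, gapCubic] at hpos; nlinarith [pow_pos hk 2]
    · intro hlt
      exact (hiff _ (hr.trans hlt)).2 hlt
  have hb : 0 < realMap h (√r) := (hh.trans hB).trans (lt_realMap hh hB)
  refine ⟨realMap h (√r), hb, ?_⟩
  have hgap : ∀ u ∈ gapSet h, 0 < u → realMap h (√r) < realMap h u := fun u hu hpos =>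
    realMap_strictMono hh hB0 ((mem_gapSet_iff hh).1 hu).le ((hmem u hpos).1 hu)
  have hsub := Ioi_subset_image_gapSet hh hB hB0
    fun t ht => (hmem t ((hh.trans hB).trans ht)).2 ht
  ext y
  rw [Set.mem_compl_iff, Set.mem_Icc]
  constructor
  · intro hy
    constructor
    · by_contra! hlt
      exact hy (mem_image_neg hh (hsub (show realMap h (√r) < -y by linarith)))
    · by_contra! hlt
      exact hy (hsub hlt)
  · rintro ⟨hy1, hy2⟩ ⟨u, hu, rfl⟩
    rcases lt_trichotomy u 0 with hneg | h0 | hpos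
    · have := hgap (-u) (neg_mem_gapSet hh hu) (by linarith)
      rw [realMap_neg] at this
      linarith
    · exact hu.1.2.1 h0
    · linarith [hgap u hu hpos]

/-- Three intervals: the cubic has a positive value in `(0, h²)`. -/
lemma compl_image_gapSet_of_three_cut {h s₀ : ℝ} (hh : 0 < h) (hs₀ : 0 < s₀) (hs₀h : s₀ < h ^ 2)
    (hF : 0 < gapCubic (h ^ 2) s₀) :
    ∃ a b d : ℝ, 0 < d ∧ d < a ∧ a < b ∧
      (realMap h '' gapSet h)ᶜ = Set.Icc (-b) (-a) ∪ Set.Icc (-d) d ∪ Set.Icc a b := by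
  obtain ⟨r₁, r₂, r₃, h1, h12, h2, h3, hfac⟩ := exists_three_roots hs₀ hs₀h hF
  have q1 : √r₁ ^ 2 = r₁ := Real.sq_sqrt h1.le
  have q2 : √r₂ ^ 2 = r₂ := Real.sq_sqrt (h1.trans h12).le
  have q3 : √r₃ ^ 2 = r₃ := Real.sq_sqrt ((sq_nonneg h).trans h3.le)
  have z1 : gapCubic (h ^ 2) (√r₁ ^ 2) = 0 := by rw [q1, hfac]; ring
  have z2 : gapCubic (h ^ 2) (√r₂ ^ 2) = 0 := by rw [q2, hfac]; ring
  have z3 : gapCubic (h ^ 2) (√r₃ ^ 2) = 0 := by rw [q3, hfac]; ring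
  have p1 : 0 < √r₁ := Real.sqrt_pos.2 h1
  have p12 : √r₁ < √r₂ := Real.sqrt_lt_sqrt h1.le h12
  have p2 : √r₂ < h := (Real.sqrt_lt' hh).2 h2
  have p3 : h < √r₃ := Real.lt_sqrt_of_sq_lt h3
  have hmem : ∀ t, 0 < t → (t ∈ gapSet h ↔ (√r₁ < t ∧ t < √r₂) ∨ √r₃ < t) := by
    intro t ht
    rw [mem_gapSet_iff hh, Real.sqrt_lt' ht, Real.lt_sqrt ht.le, Real.sqrt_lt' ht, hfac]
    constructor
    · intro hpos
      by_contra! hcon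
      obtain ⟨c1, c2⟩ := hcon
      rcases lt_or_ge r₁ (t ^ 2) with hlt | hge
      · have := mul_nonneg (mul_nonneg (by linarith : 0 ≤ 2 * (t ^ 2 - r₁))
          (sub_nonneg.2 (c1 hlt))) (sub_nonneg.2 c2)
        linarith
      · have := mul_nonneg (mul_nonneg (by linarith : 0 ≤ 2 * (r₁ - t ^ 2))
          (by linarith : 0 ≤ r₂ - t ^ 2)) (sub_nonneg.2 c2)
        linarith
    · rintro (⟨c1, c2⟩ | c3)
      · have := mul_pos (mul_pos (by linarith : 0 < 2 * (t ^ 2 - r₁)) (sub_pos.2 c2))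
          (by linarith : 0 < r₃ - t ^ 2)
        linarith
      · exact mul_pos (mul_pos (by linarith) (by linarith)) (by linarith)
  set D := √r₁
  set A := √r₂
  set B := √r₃
  have hd : 0 < realMap h D := by
    have h4 := realMap_strictMono (u := -D) hh (by rw [neg_sq, z1]) z1.ge (by linarith)
    rw [realMap_neg] at h4
    linarith
  have hda := realMap_strictMono hh z1.ge z2.ge p12
  have hab := realMap_strictMono hh z2.ge z3.ge (p2.trans p3)
  refine ⟨realMap h A, realMap h B, realMap h D, hd, hda, hab, ?_⟩
  have hgap : ∀ u ∈ gapSet h, 0 < u →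
      (realMap h D < realMap h u ∧ realMap h u < realMap h A) ∨ realMap h B < realMap h u := by
    intro u hu hpos
    have h0 := ((mem_gapSet_iff hh).1 hu).le
    rcases (hmem u hpos).1 hu with ⟨c1, c2⟩ | c3
    · exact Or.inl ⟨realMap_strictMono hh z1.ge h0 c1, realMap_strictMono hh h0 z2.ge c2⟩
    · exact Or.inr (realMap_strictMono hh z3.ge h0 c3)
  have hsub1 : Set.Ioo (realMap h D) (realMap h A) ⊆ realMap h '' gapSet h := by
    refine Ioo_subset_image_gapSet hh p12.le (fun t ht => ?_)
      fun t ht => (hmem t (p1.trans ht.1)).2 (Or.inl ht)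
    rcases ht.1.eq_or_lt with rfl | hlt
    · exact z1.ge
    rcases ht.2.eq_or_lt with rfl | hlt'
    · exact z2.ge
    · exact ((mem_gapSet_iff hh).1 ((hmem t (p1.trans hlt)).2 (Or.inl ⟨hlt, hlt'⟩))).le
  have hsub2 := Ioi_subset_image_gapSet hh p3 z3.ge
    fun t ht => (hmem t ((hh.trans p3).trans ht)).2 (Or.inr ht)
  have hpos : ∀ y, 0 ≤ y → (y ∉ realMap h '' gapSet h ↔
      y ≤ realMap h D ∨ (realMap h A ≤ y ∧ y ≤ realMap h B)) := by
    intro y hy0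
    constructor
    · intro hy
      by_contra! hcon
      rcases lt_or_ge y (realMap h A) with hlt | hge
      · exact hy (hsub1 ⟨hcon.1, hlt⟩)
      · exact hy (hsub2 (hcon.2 hge))
    · rintro hy ⟨u, hu, rfl⟩
      rcases lt_trichotomy u 0 with hneg | h0 | hpos
      · have := hgap (-u) (neg_mem_gapSet hh hu) (by linarith)
        rw [realMap_neg] at this
        rcases this with ⟨c1, -⟩ | c <;> linarith
      · exact hu.1.2.1 h0
      · rcases hgap u hu hpos with ⟨c1, c2⟩ | c <;> rcases hy with hy | ⟨hy, hy'⟩ <;> linarith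
  ext y
  simp only [Set.mem_compl_iff, Set.mem_union, Set.mem_Icc]
  rcases le_total 0 y with hy | hy
  · rw [hpos y hy]
    constructor
    · rintro (c | ⟨c1, c2⟩)
      · exact Or.inl (Or.inr ⟨by linarith, c⟩)
      · exact Or.inr ⟨c1, c2⟩
    · rintro ((⟨c1, c2⟩ | ⟨c1, c2⟩) | c)
      · linarith
      · exact Or.inl c2
      · exact Or.inr c
  · have hneg : y ∈ realMap h '' gapSet h ↔ -y ∈ realMap h '' gapSet h :=
      ⟨fun hy => mem_image_neg hh (by rwa [neg_neg]), mem_image_neg hh⟩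
    rw [hneg, hpos (-y) (by linarith)]
    constructor
    · rintro (c | ⟨c1, c2⟩)
      · exact Or.inl (Or.inr ⟨by linarith, by linarith⟩)
      · exact Or.inl (Or.inl ⟨by linarith, by linarith⟩)
    · rintro ((⟨c1, c2⟩ | ⟨c1, c2⟩) | ⟨c1, c2⟩)
      · exact Or.inr ⟨by linarith, by linarith⟩
      · exact Or.inl (by linarith)
      · linarith

/-! ### The critical parameter -/

lemma exists_critical : ∃ cstar : ℝ, 0 < cstar ∧
    (∀ t : ℝ, 0 < t → (t ^ 6 - 27 / 2 * t ^ 4 - 54 * t ^ 2 - 54 = 0 ↔ t = cstar)) ∧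
    |cstar - 4.10938818| < 5 * (10 : ℝ) ^ (-9 : ℤ) := by
  have hc : Continuous fun t : ℝ => t ^ 6 - 27 / 2 * t ^ 4 - 54 * t ^ 2 - 54 := by fun_prop
  obtain ⟨c, hc, hc0⟩ := intermediate_value_Ioo
    (by norm_num : (4.109388175 : ℝ) ≤ 4.109388185) hc.continuousOn
    (show (0 : ℝ) ∈ _ from ⟨by norm_num, by norm_num⟩)
  have hcpos : 0 < c := lt_trans (by norm_num) hc.1
  refine ⟨c, hcpos, fun t ht => ⟨fun h0 => ?_, fun h0 => by rw [h0]; exact hc0⟩, ?_⟩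
  · simp only at hc0
    -- eliminating the leading coefficient from the two equations leaves positive cofactors
    have h1 : (t ^ 2 - c ^ 2) * (27 / 2 * t ^ 4 * c ^ 4 + 54 * t ^ 2 * c ^ 2 * (t ^ 2 + c ^ 2)
        + 54 * (t ^ 4 + t ^ 2 * c ^ 2 + c ^ 4)) = 0 := by
      linear_combination c ^ 6 * h0 - t ^ 6 * hc0
    have h2 : t ^ 2 - c ^ 2 = 0 := (mul_eq_zero.1 h1).resolve_right (by positivity)
    nlinarith
  · rw [abs_lt]
    constructor <;> norm_num <;> linarith [hc.1, hc.2]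

/-- The critical parameter, characterized by a double root of the cubic: with `K = c*² / 4`, the
double root is `K σ`, and `3 σ³ + 3 σ² + 3 σ = 1`. -/
lemma exists_double_root {c : ℝ}
    (huniq : ∀ t : ℝ, 0 < t → (t ^ 6 - 27 / 2 * t ^ 4 - 54 * t ^ 2 - 54 = 0 ↔ t = c)) :
    ∃ σ : ℝ, 0 < σ ∧ σ < 1 ∧ 3 * σ ^ 3 + 3 * σ ^ 2 + 3 * σ - 1 = 0 ∧
      c ^ 2 / 4 * (2 * σ * (1 - σ) ^ 2) = 3 * σ ^ 2 + 1 := by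
  have hcont : Continuous fun t : ℝ => 3 * t ^ 3 + 3 * t ^ 2 + 3 * t - 1 := by fun_prop
  obtain ⟨σ, hσ, e⟩ := intermediate_value_Ioo (by norm_num : (0 : ℝ) ≤ 1) hcont.continuousOn
    (show (0 : ℝ) ∈ _ from ⟨by norm_num, by norm_num⟩)
  obtain ⟨h0, h1⟩ := hσ
  simp only at e
  refine ⟨σ, h0, h1, e, ?_⟩
  have hM : 0 < 2 * σ * (1 - σ) ^ 2 := by
    have := sub_pos.2 h1
    positivity
  set K := (3 * σ ^ 2 + 1) / (2 * σ * (1 - σ) ^ 2) with hK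
  have hKpos : 0 < K := by positivity
  have hKM : K * (2 * σ * (1 - σ) ^ 2) = 3 * σ ^ 2 + 1 := div_mul_cancel₀ _ hM.ne'
  have hcub : 32 * K ^ 3 - 108 * K ^ 2 - 108 * K - 27 = 0 := by
    have h2 : (32 * K ^ 3 - 108 * K ^ 2 - 108 * K - 27) * (2 * σ * (1 - σ) ^ 2) ^ 3 = 0 := by
      have h3 : (32 * K ^ 3 - 108 * K ^ 2 - 108 * K - 27) * (2 * σ * (1 - σ) ^ 2) ^ 3 =
          32 * (K * (2 * σ * (1 - σ) ^ 2)) ^ 3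
            - 108 * (K * (2 * σ * (1 - σ) ^ 2)) ^ 2 * (2 * σ * (1 - σ) ^ 2)
            - 108 * (K * (2 * σ * (1 - σ) ^ 2)) * (2 * σ * (1 - σ) ^ 2) ^ 2
            - 27 * (2 * σ * (1 - σ) ^ 2) ^ 3 := by ring
      rw [h3, hKM]
      linear_combination
        (-32 + 120 * σ - 24 * σ ^ 2 + 192 * σ ^ 3 + 72 * σ ^ 5 - 72 * σ ^ 6) * e
    exact (mul_eq_zero.1 h2).resolve_right (pow_ne_zero 3 hM.ne')
  have hroot : 2 * √K = c := by
    refine (huniq _ (by positivity)).1 ?_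
    have h4 : (2 * √K) ^ 2 = 4 * K := by rw [mul_pow, Real.sq_sqrt hKpos.le]; ring
    have h5 : (2 * √K) ^ 6 - 27 / 2 * (2 * √K) ^ 4 - 54 * (2 * √K) ^ 2 - 54 =
        ((2 * √K) ^ 2) ^ 3 - 27 / 2 * ((2 * √K) ^ 2) ^ 2 - 54 * (2 * √K) ^ 2 - 54 := by ring
    rw [h5, h4]
    linear_combination 2 * hcub
  have : c ^ 2 / 4 = K := by rw [← hroot, mul_pow, Real.sq_sqrt hKpos.le]; ring
  rw [this, hKM]

lemma gapCubic_mul (k σ : ℝ) :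
    gapCubic k (k * σ) = k ^ 2 * (k * (2 * σ * (1 - σ) ^ 2) - (3 * σ ^ 2 + 1)) := by
  rw [gapCubic]; ring

/-- For `k ≤ c*² / 4`, the cubic has no positive value in `(0, k)`. -/
lemma gapCubic_nonpos_of_le {K σ k s : ℝ} (h0 : 0 < σ) (h1 : σ < 1)
    (e : 3 * σ ^ 3 + 3 * σ ^ 2 + 3 * σ - 1 = 0)
    (hK : K * (2 * σ * (1 - σ) ^ 2) = 3 * σ ^ 2 + 1) (hkK : k ≤ K) (hs : 0 < s) (hsk : s < k) :
    gapCubic k s ≤ 0 := by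
  have hk : 0 < k := hs.trans hsk
  obtain ⟨x, rfl⟩ : ∃ x, s = k * x := ⟨s / k, by field_simp⟩
  have hx0 : 0 < x := (pos_iff_pos_of_mul_pos hs).1 hk
  have hx1 : x < 1 := by
    by_contra! hge
    nlinarith
  rw [gapCubic_mul]
  refine mul_nonpos_of_nonneg_of_nonpos (sq_nonneg k) ?_
  have hM : 0 < 2 * σ * (1 - σ) ^ 2 := by
    have := sub_pos.2 h1
    positivity
  have hid : σ * ((3 * x ^ 2 + 1) * (2 * σ * (1 - σ) ^ 2)
      - (3 * σ ^ 2 + 1) * (2 * x * (1 - x) ^ 2)) =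
      (x - σ) ^ 2 * (2 * (1 - σ) ^ 2 - 2 * (3 * σ ^ 2 + 1) * x * σ) := by
    linear_combination (-2 * x * σ + 2 * x * σ ^ 2 + 2 * x ^ 2 - 2 * x ^ 2 * σ) * e
  have hnn : 0 ≤ 2 * (1 - σ) ^ 2 - 2 * (3 * σ ^ 2 + 1) * x * σ := by
    have h3 : (3 * σ ^ 2 + 1) * σ * x ≤ (3 * σ ^ 2 + 1) * σ * 1 := by gcongr
    nlinarith [sq_nonneg σ]
  have h4 : 0 ≤ σ * ((3 * x ^ 2 + 1) * (2 * σ * (1 - σ) ^ 2)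
      - (3 * σ ^ 2 + 1) * (2 * x * (1 - x) ^ 2)) := by
    rw [hid]; exact mul_nonneg (sq_nonneg _) hnn
  have h5 : 0 ≤ (3 * x ^ 2 + 1) * (2 * σ * (1 - σ) ^ 2)
      - (3 * σ ^ 2 + 1) * (2 * x * (1 - x) ^ 2) := nonneg_of_mul_nonneg_right h4 h0
  have h6 : 0 ≤ ((3 * x ^ 2 + 1) - K * (2 * x * (1 - x) ^ 2)) * (2 * σ * (1 - σ) ^ 2) := by
    rw [← hK] at h5
    linarith
  have h7 := nonneg_of_mul_nonneg_left h6 hM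
  have h8 : k * (2 * x * (1 - x) ^ 2) ≤ K * (2 * x * (1 - x) ^ 2) := by gcongr
  linarith

/-- For `k > c*² / 4`, the cubic is positive somewhere in `(0, k)`. -/
lemma gapCubic_pos_of_gt {K σ k : ℝ} (h0 : 0 < σ) (h1 : σ < 1) (hk : 0 < k)
    (hK : K * (2 * σ * (1 - σ) ^ 2) = 3 * σ ^ 2 + 1) (hkK : K < k) :
    0 < gapCubic k (k * σ) := by
  rw [gapCubic_mul, ← hK, ← sub_mul]
  have := sub_pos.2 h1
  have := sub_pos.2 hkK
  positivity

/-! ### The limiting density and the theorem -/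

/-- The limiting distribution has a density, namely its Radon-Nikodym derivative. -/
lemma exists_density {h : ℝ} {μ : Measure ℝ} [IsProbabilityMeasure μ]
    (hμ : SolvesSourceEquation h μ) :
    ∃ v : ℝ → ℝ, IsProbabilityDensity v ∧ (∀ f : ℝ → ℝ, ∫ x, f x * v x = ∫ x, f x ∂μ) ∧
      densitySupport v = (realMap h '' gapSet h)ᶜ := by
  have hac := hμ.absolutelyContinuous
  refine ⟨fun x => (μ.rnDeriv volume x).toReal,
    ⟨(Measure.measurable_rnDeriv _ _).ennreal_toReal, fun x => ENNReal.toReal_nonneg,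
      Measure.integrable_toReal_rnDeriv, ?_⟩, fun f => ?_, ?_⟩
  · rw [Measure.integral_toReal_rnDeriv hac]; simp
  · rw [← integral_rnDeriv_smul hac]
    simp only [smul_eq_mul, mul_comm]
  · rw [densitySupport, ← hμ.support_eq]
    congr 1
    rw [← Measure.withDensity_rnDeriv_eq μ volume hac]
    refine withDensity_congr_ae ?_
    rw [Measure.withDensity_rnDeriv_eq μ volume hac]
    filter_upwards [Measure.rnDeriv_lt_top μ volume] with x hx
    exact ENNReal.ofReal_toReal hx.ne

lemma integral_zeroMeasure (h : ℝ) (n : ℕ) (f : ℝ → ℝ) :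
    ∫ x, f x ∂(zeroMeasure h n) = 1 / (3 * ((n + 1 : ℕ) : ℝ)) *
      ((heat (-1 / 2) (sourcePoly (√((n + 1 : ℕ) : ℝ) * h) (n + 1))).roots.map
        fun x => f (x / √((n + 1 : ℕ) : ℝ))).sum := by
  rw [zeroMeasure, integral_empiricalMeasure, card_scaledZeros, scaledZeros, Multiset.map_map]
  simp

theorem theorem3p2 :
    ∃ cstar : ℝ, 0 < cstar ∧
      (∀ t : ℝ, 0 < t →
        (t ^ 6 - 27 / 2 * t ^ 4 - 54 * t ^ 2 - 54 = 0 ↔ t = cstar)) ∧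
      |cstar - 4.10938818| < 5 * (10 : ℝ) ^ (-9 : ℤ) ∧
      ∀ chat : ℝ, 0 < chat →
        -- the polynomials `H_{n,n,n}` with `c = √n ĉ` are well defined
        (∀ n : ℕ, 1 ≤ n → ∃! P : ℝ[X], IsHnnn (√(n : ℝ) * chat) n P) ∧
        -- their zeros are real and simple
        (∀ n : ℕ, 1 ≤ n → ∀ P : ℝ[X], IsHnnn (√(n : ℝ) * chat) n P →
          Multiset.card P.roots = 3 * n ∧ P.roots.Nodup) ∧
        -- the limiting density, with its support
        ∃ v : ℝ → ℝ, IsProbabilityDensity v ∧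
          (∀ H : ℕ → ℝ[X], (∀ n : ℕ, 1 ≤ n → IsHnnn (√(n : ℝ) * chat) n (H n)) →
            ∀ f : ℝ →ᵇ ℝ,
              Tendsto
                (fun n : ℕ =>
                  1 / (3 * (n : ℝ)) * ((H n).roots.map fun x => f (x / √(n : ℝ))).sum)
                atTop (𝓝 (∫ x, f x * v x))) ∧
          (cstar < chat → ∃ a b d : ℝ, 0 < d ∧ d < a ∧ a < b ∧
            densitySupport v = Set.Icc (-b) (-a) ∪ Set.Icc (-d) d ∪ Set.Icc a b) ∧
          (chat < cstar → ∃ b : ℝ, 0 < b ∧ densitySupport v = Set.Icc (-b) b) := by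
  obtain ⟨cstar, hpos, huniq, hnum⟩ := exists_critical
  obtain ⟨σ, hσ0, hσ1, hσ, hK⟩ := exists_double_root huniq
  refine ⟨cstar, hpos, huniq, hnum, fun chat hchat => ?_⟩
  have hh : 0 < chat / 2 := by positivity
  have hiff : ∀ n : ℕ, 1 ≤ n → ∀ P : ℝ[X], IsHnnn (√(n : ℝ) * chat) n P ↔
      P = heat (-1 / 2) (sourcePoly (√(n : ℝ) * (chat / 2)) n) := by
    intro n hn P
    have hn' : (0 : ℝ) < n := by exact_mod_cast hn
    rw [isHnnn_iff (by positivity), mul_div_assoc]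
  obtain ⟨μ, hμ, hlim⟩ := exists_limit_measure hh
  obtain ⟨v, hv, hint, hsupp⟩ := exists_density hμ
  refine ⟨fun n hn => ⟨_, (hiff n hn _).2 rfl, fun P hP => (hiff n hn P).1 hP⟩, ?_,
    v, hv, ?_, ?_, ?_⟩
  · intro n hn P hP
    have hS := hasSimpleRealRoots_heat_sourcePoly (√(n : ℝ) * (chat / 2)) n
    rw [← (hiff n hn P).1 hP] at hS
    refine ⟨?_, hS.nodup⟩
    rw [hS.card, (hiff n hn P).1 hP, (monic_heat (monic_sourcePoly _ _).1).2,
      (monic_sourcePoly _ _).2]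
  · intro H hH f
    rw [hint, ← tendsto_add_atTop_iff_nat 1]
    refine (hlim f).congr fun n => ?_
    rw [integral_zeroMeasure, (hiff (n + 1) (by omega) _).1 (hH (n + 1) (by omega))]
  · intro hlt
    rw [hsupp]
    have hk : 0 < (chat / 2) ^ 2 := by positivity
    have hlt' : cstar ^ 2 / 4 < (chat / 2) ^ 2 := by nlinarith
    exact compl_image_gapSet_of_three_cut hh (mul_pos hk hσ0)
      (mul_lt_of_lt_one_right hk hσ1) (gapCubic_pos_of_gt hσ0 hσ1 hk hK hlt')
  · intro hlt
    rw [hsupp]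
    have hle : (chat / 2) ^ 2 ≤ cstar ^ 2 / 4 := by nlinarith
    exact compl_image_gapSet_of_one_cut hh fun s hs hsk =>
      gapCubic_nonpos_of_le hσ0 hσ1 hσ hK hle hs hsk
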